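/- **Theorem (iteration complexity of the mixture of damped Newton and Newton methods).** Let $f:\mathbb R^N\to\mathbb R\cup\{\infty\}$ be a standard self-concordant function: $f$ is closed and convex, its domain $\mathrm{dom}(f)=\{x: f(x)<\infty\}$ is open, $f$ is three times continuously differentiable on $\mathrm{dom}(f)$, and $|\psi'''(0)|\le 2\,(\psi''(0))^{3/2}$ for all $x\in\mathrm{dom}(f)$ and $u\in\mathbb R^N$, where $\psi(t)=f(x+tu)$. Suppose that $\nabla^2 f(x)$ is positive definite for every $x\in\mathrm{dom}(f)$ and that $f$ has a unique minimizer over $\mathbb R^N$; let $f^*=\min f$. For $x\in\mathrm{dom}(f)$ let $$\tilde d(x)=\arg\min_{d}\Big\{f(x)+\langle\nabla f(x),d\rangle+\tfrac12\langle d,\nabla^2 f(x)d\rangle\Big\},\qquad \tilde\lambda(x)=\sqrt{\langle \tilde d(x),\nabla^2 f(x)\tilde d(x)\rangle}.$$ Let $x^0\in\mathrm{dom}(f)$, $\beta\in(0,(3-\sqrt5)/2)$ and $\epsilon>0$, and consider the following two-stage method started at $x^0$. The first stage performs the damped Newton iterations $x^{k+1}=x^k+\tilde d(x^k)/(1+\tilde\lambda(x^k))$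 until the first iterate $x^{K_1}$ with $\tilde\lambda(x^{K_1})\le\beta$. The second stage performs the Newton iterations $x^{k+1}=x^k+\tilde d(x^k)$, starting at $x^{K_1}$, until the first iterate $x^{K_2}$, $K_2\ge K_1$, with $\tilde\lambda(x^{K_2})\le\epsilon$. Then the method is well defined (all iterates $x^0,\dots,x^{K_2}$ lie in $\mathrm{dom}(f)$ and $\tilde d(x^k)$ exists and is unique for each of them), it terminates, and the total number of iterations satisfies $$K_2\le\min\left\{\left\lceil\left[\frac{\log\omega(\beta)-\log\delta_0}{\log\left(1-\frac{1-\omega_*^{-1}(\delta_0)}{1+\omega_*^{-1}(\delta_0)}\right)}\right]_+\right\rceil,\ \left\lceil\frac{\delta_0}{\omega(\beta)}\right\rceil\right\}+\left\lceil\log_2\left(\frac{\log\epsilon-2\log(1-\beta)}{\log\beta-2\log(1-\beta)}\right)\right\rceil,$$ where $\delta_0=f(x^0)-f^*$, $\omega(t)=t-\ln(1+t)$, $\omega_*(t)=-t-\ln(1-t)$, $\omega_*^{-1}:[0,\infty)\to[0,1)$ is the inverse of $\omega_*$ restricted to $[0,1)$, and $t_+=\max(t,0)$. Here the minimum is read as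 $0$ if $\delta_0=0$, and the last term (the $\lceil\log_2(\cdot)\rceil$) is read as $0$ if $\epsilon>\beta$. -/

import Mathlib

open Set
open scoped RealInnerProductSpace Gradient

noncomputable section

namespace SelfConcordantMin

variable {N : ℕ}

/-- The effective domain of an extended-real-valued function. -/
def dom (f : EuclideanSpace ℝ (Fin N) → EReal) : Set (EuclideanSpace ℝ (Fin N)) :=
  {x | f x ≠ ⊤}

/-- The real-valued function that agrees with `f` on `dom f`. -/
def realVal (f : EuclideanSpace ℝ (Fin N) → EReal) (x : EuclideanSpace ℝ (Fin N)) : ℝ :=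
  (f x).toReal

/-- `f : ℝ^N → ℝ ∪ {∞}` is self-concordant with parameter `M`: it is a closed convex function,
three times continuously differentiable on its open domain, and `|ψ'''(0)| ≤ M (ψ''(0))^{3/2}`
for `ψ(t) = f(x + t u)`, for all `x ∈ dom f` and all `u`. -/
structure IsSelfConcordant (M : ℝ) (f : EuclideanSpace ℝ (Fin N) → EReal) : Prop where
  nonneg : 0 ≤ M
  ne_bot : ∀ x, f x ≠ ⊥
  closed : LowerSemicontinuous f
  isOpen_dom : IsOpen (dom f)
  convex : ConvexOn ℝ (dom f) (realVal f)
  contDiff : ContDiffOn ℝ 3 (realVal f) (dom f)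
  third_deriv_le : ∀ x ∈ dom f, ∀ u : EuclideanSpace ℝ (Fin N),
    |iteratedDeriv 3 (fun t : ℝ => realVal f (x + t • u)) 0|
      ≤ M * (iteratedDeriv 2 (fun t : ℝ => realVal f (x + t • u)) 0) ^ (3 / 2 : ℝ)

/-- A standard self-concordant function has parameter `2`. -/
def IsStandardSelfConcordant (f : EuclideanSpace ℝ (Fin N) → EReal) : Prop :=
  IsSelfConcordant 2 f

/-- The Hessian `∇² f(x)` as a linear operator: the derivative of the gradient. -/
def hessian (f : EuclideanSpace ℝ (Fin N) → EReal) (x : EuclideanSpace ℝ (Fin N)) :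
    EuclideanSpace ℝ (Fin N) →L[ℝ] EuclideanSpace ℝ (Fin N) :=
  fderiv ℝ (gradient (realVal f)) x

/-- The local norm `‖u‖_x = √⟨u, ∇² f(x) u⟩`. -/
def localNorm (f : EuclideanSpace ℝ (Fin N) → EReal) (x u : EuclideanSpace ℝ (Fin N)) : ℝ :=
  Real.sqrt ⟪u, hessian f x u⟫

/-- The quadratic model `d ↦ f(x) + ⟨∇f(x), d⟩ + ½⟨d, ∇²f(x) d⟩`. -/
def quadModel (f : EuclideanSpace ℝ (Fin N) → EReal) (x d : EuclideanSpace ℝ (Fin N)) : ℝ :=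
  realVal f x + ⟪gradient (realVal f) x, d⟫ + 1 / 2 * ⟪d, hessian f x d⟫

/-- `d` is a minimizer of the quadratic model of `f` at `x`. -/
def IsNewtonDir (f : EuclideanSpace ℝ (Fin N) → EReal) (x d : EuclideanSpace ℝ (Fin N)) : Prop :=
  IsMinOn (quadModel f x) univ d

/-- The Newton direction `d̃(x) = argmin_d {f(x) + ⟨∇f(x), d⟩ + ½⟨d, ∇²f(x) d⟩}`
(an arbitrary vector if there is no minimizer). -/
def newtonDir (f : EuclideanSpace ℝ (Fin N) → EReal) (x : EuclideanSpace ℝ (Fin N)) :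
    EuclideanSpace ℝ (Fin N) :=
  Classical.epsilon (IsNewtonDir f x)

/-- The Newton decrement `λ̃(x) = ‖d̃(x)‖_x`. -/
def newtonDecrement (f : EuclideanSpace ℝ (Fin N) → EReal) (x : EuclideanSpace ℝ (Fin N)) : ℝ :=
  localNorm f x (newtonDir f x)

/-- One damped Newton iteration. -/
def dampedNewtonStep (f : EuclideanSpace ℝ (Fin N) → EReal) (x : EuclideanSpace ℝ (Fin N)) :
    EuclideanSpace ℝ (Fin N) :=
  x + (1 + newtonDecrement f x)⁻¹ • newtonDir f x

/-- One standard Newton iteration. -/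
def newtonStep (f : EuclideanSpace ℝ (Fin N) → EReal) (x : EuclideanSpace ℝ (Fin N)) :
    EuclideanSpace ℝ (Fin N) :=
  x + newtonDir f x

/-- A complete run of the mixture of the damped Newton and Newton methods started at `x₀`, with
iterates `x 0, …, x K₂`: the first stage performs damped Newton iterations until the first iterate
`x K₁` with `λ̃ ≤ β`; the second stage performs Newton iterations from `x K₁` on, until the first
iterate `x K₂` with `λ̃ ≤ ε`. In total `K₂` iterations are performed. -/
structure IsMixtureRun (f : EuclideanSpace ℝ (Fin N) → EReal) (β ε : ℝ)
    (x₀ : EuclideanSpace ℝ (Fin N)) (x : ℕ → EuclideanSpace ℝ (Fin N)) (K₁ K₂ : ℕ) : Prop where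
  init : x 0 = x₀
  le : K₁ ≤ K₂
  damped : ∀ k < K₁, β < newtonDecrement f (x k) ∧ x (k + 1) = dampedNewtonStep f (x k)
  switch : newtonDecrement f (x K₁) ≤ β
  newton : ∀ k, K₁ ≤ k → k < K₂ →
    ε < newtonDecrement f (x k) ∧ x (k + 1) = newtonStep f (x k)
  terminate : newtonDecrement f (x K₂) ≤ ε

/-- The optimality gap `f(x) - f*`, where `f*` is the minimal value of `f`. -/
def optGap (f : EuclideanSpace ℝ (Fin N) → EReal) (x : EuclideanSpace ℝ (Fin N)) : ℝ :=
  (f x).toReal - (⨅ y, f y).toReal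

/-- `ω(t) = t - ln(1 + t)`. -/
def omega (t : ℝ) : ℝ := t - Real.log (1 + t)

/-- `ω_*(t) = -t - ln(1 - t)`. -/
def omegaStar (t : ℝ) : ℝ := -t - Real.log (1 - t)

/-- The inverse of `ω_*` restricted to `[0, 1)`, a function from `[0, ∞)` to `[0, 1)`. -/
def omegaStarInv (s : ℝ) : ℝ := Function.invFunOn omegaStar (Ico 0 1) s

/-- The bound `min {⌈[(log ω(β) - log δ) / log (1 - (1 - ω_*⁻¹(δ)) / (1 + ω_*⁻¹(δ)))]₊⌉, ⌈δ / ω(β)⌉}`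
for the first stage. It is `0` if `δ = 0`, on account of the second entry. -/
def stageOneBound (β δ : ℝ) : ℤ :=
  min
    ⌈max ((Real.log (omega β) - Real.log δ) /
      Real.log (1 - (1 - omegaStarInv δ) / (1 + omegaStarInv δ))) 0⌉
    ⌈δ / omega β⌉

/-- The bound `⌈log₂ ((log ε - 2 log (1 - β)) / (log β - 2 log (1 - β)))⌉` for the second stage.
It is `0` if `ε > β`, in which case the second stage performs no iteration; there the argument of
`log₂` is less than `1`, or negative. -/
def stageTwoBound (β ε : ℝ) : ℤ :=
  if ε ≤ β then
    ⌈Real.logb 2 ((Real.log ε - 2 * Real.log (1 - β)) / (Real.log β - 2 * Real.log (1 - β)))⌉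
  else 0

end SelfConcordantMin

end

namespace SelfConcordantMin

/-! ### Scalar inequalities -/

/-! Self-concordance bounds the third derivative on the diagonal only. Polarizing it without loss of
constant (`abs_trilinear_le`, Banach's theorem for a symmetric cubic form, reduced to a plane) gives
|∇³f[u,u,v]| ≤ 2‖u‖²‖v‖ in the local norm. On a segment x + tv in the domain, this controls how the
Hessian varies in terms of r = ‖v‖_x. Integration gives f(x+v) ≤ f(x) + ⟨∇f(x),v⟩ + ω_*(r) for r <
1, the same lower bound with ω(r), and an estimate of the gradient at x + v. By the upper bound and
lower semicontinuity, f stays finite on the open unit ball of the local norm, so the steps never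
leave the domain (`add_mem_dom`).

First stage: a damped step lowers f by at least ω(λ), hence by more than ω(β) while λ > β; counting
gives δ₀/ω(β). The lower bound and Fenchel–Young give f(x) - f* ≤ ω_*(λ) when λ < 1, so λ ≥
ω_*⁻¹(δ). With ω(t) ≥ (1-t)/(1+t)·ω_*(t) the decrease is also a fixed fraction of the gap, which
gives the logarithmic count.

Second stage: a Newton step yields λ₊ ≤ λ²/(1-λ)², so λ/(1-β)² is at least squared at each step. It
starts at most at β/(1-β)², and β < (3-√5)/2 makes this less than 1; taking logarithms twice gives
the log₂ bound. -/

/-- The weights `wⱼ = (1 + 2 cos 2τⱼ)² / 9` at the angles `τⱼ = τ + 2πj/3` and the moments of order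
three of the corresponding measure, where `a = cos τ`, `b = sin τ` and `k = sin (2π/3)`. -/
theorem threePoint_moments {a b k a₂ a₃ : ℝ} (hab : a ^ 2 + b ^ 2 = 1) (hk : k ^ 2 = 3 / 4)
    (ha₂ : a₂ = -a / 2 - k * b) (ha₃ : a₃ = -a / 2 + k * b)
    {w : ℝ → ℝ} (hw : w = fun a => (4 * a ^ 2 - 1) ^ 2 / 9) :
    w a + w a₂ + w a₃ = 1 ∧
    w a * a ^ 3 + w a₂ * a₂ ^ 3 + w a₃ * a₃ ^ 3 = 4 * a ^ 3 - 3 * a := by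
  subst hw ha₂ ha₃
  constructor
  · grind
  · grind

/-- With the two lemmas that follow, this evaluates the remaining cubic moments. On average only the
coefficients A and B of a cubic form survive, with factors cos 3τ and sin 3τ. -/
theorem threePoint_mixed_moment {a b k a₂ b₂ a₃ b₃ : ℝ} (hab : a ^ 2 + b ^ 2 = 1)
    (hk : k ^ 2 = 3 / 4)
    (ha₂ : a₂ = -a / 2 - k * b) (hb₂ : b₂ = -b / 2 + k * a)
    (ha₃ : a₃ = -a / 2 + k * b) (hb₃ : b₃ = -b / 2 - k * a)
    {w : ℝ → ℝ} (hw : w = fun a => (4 * a ^ 2 - 1) ^ 2 / 9) :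
    3 * (w a * a ^ 2 * b + w a₂ * a₂ ^ 2 * b₂ + w a₃ * a₃ ^ 2 * b₃) = 3 * b - 4 * b ^ 3 := by
  subst hw ha₂ ha₃ hb₂ hb₃
  grind

theorem threePoint_mixed_moment' {a b k a₂ b₂ a₃ b₃ : ℝ} (hab : a ^ 2 + b ^ 2 = 1)
    (hk : k ^ 2 = 3 / 4)
    (ha₂ : a₂ = -a / 2 - k * b) (hb₂ : b₂ = -b / 2 + k * a)
    (ha₃ : a₃ = -a / 2 + k * b) (hb₃ : b₃ = -b / 2 - k * a)
    {w : ℝ → ℝ} (hw : w = fun a => (4 * a ^ 2 - 1) ^ 2 / 9) :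
    w a * a * b ^ 2 + w a₂ * a₂ * b₂ ^ 2 + w a₃ * a₃ * b₃ ^ 2 = 0 := by
  subst hw ha₂ ha₃ hb₂ hb₃
  grind

theorem threePoint_sin_moment {a b k a₂ b₂ a₃ b₃ : ℝ} (hab : a ^ 2 + b ^ 2 = 1)
    (hk : k ^ 2 = 3 / 4)
    (ha₂ : a₂ = -a / 2 - k * b) (hb₂ : b₂ = -b / 2 + k * a)
    (ha₃ : a₃ = -a / 2 + k * b) (hb₃ : b₃ = -b / 2 - k * a)
    {w : ℝ → ℝ} (hw : w = fun a => (4 * a ^ 2 - 1) ^ 2 / 9) :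
    w a * b ^ 3 + w a₂ * b₂ ^ 3 + w a₃ * b₃ ^ 3 = 0 := by
  subst hw ha₂ ha₃ hb₂ hb₃
  grind

/-- A binary cubic form bounded by `M` on the unit circle has a polar form bounded by `M`. -/
theorem abs_polar_cubic_le {A B C D M : ℝ}
    (h : ∀ a b : ℝ, a ^ 2 + b ^ 2 = 1 →
      |A * a ^ 3 + 3 * B * a ^ 2 * b + 3 * C * a * b ^ 2 + D * b ^ 3| ≤ M)
    {c s : ℝ} (hcs : c ^ 2 + s ^ 2 = 1) : |A * c + B * s| ≤ M := by
  -- Trisect the angle: (c, s) = (cos 3τ, sin 3τ) with (a, b) = (cos τ, sin τ). The polar value at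
  -- (c, s) is then a convex combination of the values of the form at the angles τ + 2πj/3.
  obtain ⟨a, b, hab, rfl, rfl⟩ : ∃ a b : ℝ, a ^ 2 + b ^ 2 = 1 ∧ c = 4 * a ^ 3 - 3 * a ∧
      s = 3 * b - 4 * b ^ 3 := by
    have hn : ‖(⟨c, s⟩ : ℂ)‖ = 1 := by
      rw [Complex.norm_def, Complex.normSq_mk, ← sq, ← sq, hcs, Real.sqrt_one]
    have h0 : (⟨c, s⟩ : ℂ) ≠ 0 := by
      intro h0
      simp [h0] at hn
    set θ := Complex.arg ⟨c, s⟩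
    have h3 : 3 * (θ / 3) = θ := by ring
    refine ⟨Real.cos (θ / 3), Real.sin (θ / 3), Real.cos_sq_add_sin_sq _, ?_, ?_⟩
    · rw [← Real.cos_three_mul, h3, Complex.cos_arg h0, hn]
      simp
    · rw [← Real.sin_three_mul, h3, Complex.sin_arg, hn]
      simp
  obtain ⟨k, hk⟩ : ∃ k : ℝ, k ^ 2 = 3 / 4 := ⟨√(3 / 4), Real.sq_sqrt (by norm_num)⟩
  set p : ℝ → ℝ → ℝ := fun a b =>
    A * a ^ 3 + 3 * B * a ^ 2 * b + 3 * C * a * b ^ 2 + D * b ^ 3 with hp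
  set w : ℝ → ℝ := fun a => (4 * a ^ 2 - 1) ^ 2 / 9 with hw
  have w0 : ∀ a, 0 ≤ w a := fun a => by simp only [hw]; positivity
  obtain ⟨a₂, ha₂⟩ : ∃ x, x = -a / 2 - k * b := ⟨_, rfl⟩
  obtain ⟨b₂, hb₂⟩ : ∃ x, x = -b / 2 + k * a := ⟨_, rfl⟩
  obtain ⟨a₃, ha₃⟩ : ∃ x, x = -a / 2 + k * b := ⟨_, rfl⟩
  obtain ⟨b₃, hb₃⟩ : ∃ x, x = -b / 2 - k * a := ⟨_, rfl⟩
  have h1 := h a b hab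
  have h2 := h a₂ b₂ (by rw [ha₂, hb₂]; linear_combination (1 / 4 + k ^ 2) * hab + hk)
  have h3 := h a₃ b₃ (by rw [ha₃, hb₃]; linear_combination (1 / 4 + k ^ 2) * hab + hk)
  obtain ⟨e0, e1⟩ := threePoint_moments hab hk ha₂ ha₃ hw
  have e2 := threePoint_mixed_moment hab hk ha₂ hb₂ ha₃ hb₃ hw
  have e3 := threePoint_mixed_moment' hab hk ha₂ hb₂ ha₃ hb₃ hw
  have e4 := threePoint_sin_moment hab hk ha₂ hb₂ ha₃ hb₃ hw
  have e0' := congrArg (M * ·) e0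
  have key : A * (4 * a ^ 3 - 3 * a) + B * (3 * b - 4 * b ^ 3) =
      w a * p a b + w a₂ * p a₂ b₂ + w a₃ * p a₃ b₃ := by
    simp only [hp]
    linear_combination -A * e1 - B * e2 - 3 * C * e3 - D * e4
  rw [key]
  rw [abs_le] at h1 h2 h3 ⊢
  constructor <;>
  linarith [mul_le_mul_of_nonneg_left h1.1 (w0 a), mul_le_mul_of_nonneg_left h2.1 (w0 a₂),
    mul_le_mul_of_nonneg_left h3.1 (w0 a₃), mul_le_mul_of_nonneg_left h1.2 (w0 a),
    mul_le_mul_of_nonneg_left h2.2 (w0 a₂), mul_le_mul_of_nonneg_left h3.2 (w0 a₃)]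

/-- The device behind all the integrated estimates below: `h` is a quantity along the segment minus
an explicit comparison function, so a pointwise bound on second derivatives is integrated twice. -/
theorem image_one_le_of_second_deriv_nonpos {h h₁ h₂ : ℝ → ℝ}
    (H₁ : ∀ t ∈ Icc (0 : ℝ) 1, HasDerivAt h (h₁ t) t)
    (H₂ : ∀ t ∈ Icc (0 : ℝ) 1, HasDerivAt h₁ (h₂ t) t)
    (hle : ∀ t ∈ Icc (0 : ℝ) 1, h₂ t ≤ 0) (h0 : h₁ 0 ≤ 0) : h 1 ≤ h 0 := by
  have anti : ∀ {g g' : ℝ → ℝ}, (∀ t ∈ Icc (0 : ℝ) 1, HasDerivAt g (g' t) t) →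
      (∀ t ∈ Icc (0 : ℝ) 1, g' t ≤ 0) → AntitoneOn g (Icc 0 1) := by
    intro g g' hg hg'
    refine antitoneOn_of_hasDerivWithinAt_nonpos (convex_Icc 0 1)
      (fun t ht => (hg t ht).continuousAt.continuousWithinAt)
      (fun t ht => (hg t (interior_subset ht)).hasDerivWithinAt)
      (fun t ht => hg' t (interior_subset ht))
  have a1 := anti H₂ hle
  have a0 := anti H₁ fun t ht => (a1 (by simp) ht ht.1).trans h0
  exact a0 (by simp) (by simp) zero_le_one

/-! ### The functions ω and ω_* -/

theorem hasDerivAt_omega {t : ℝ} (ht : -1 < t) : HasDerivAt omega (t / (1 + t)) t := by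
  have h1 : 1 + t ≠ 0 := by linarith
  have := (hasDerivAt_id t).sub (((hasDerivAt_id t).const_add 1).log h1)
  refine this.congr_deriv ?_
  simp only [id]
  field_simp
  ring

theorem hasDerivAt_omegaStar {t : ℝ} (ht : t < 1) : HasDerivAt omegaStar (t / (1 - t)) t := by
  have h1 : 1 - t ≠ 0 := by linarith
  have := (hasDerivAt_id t).neg.sub (((hasDerivAt_id t).const_sub 1).log h1)
  refine this.congr_deriv ?_
  simp only [id]
  field_simp
  ring

@[simp] theorem omega_zero : omega 0 = 0 := by simp [omega]

@[simp] theorem omegaStar_zero : omegaStar 0 = 0 := by simp [omegaStar]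

theorem strictMonoOn_omega : StrictMonoOn omega (Ici 0) := by
  refine strictMonoOn_of_hasDerivWithinAt_pos (f' := fun t => t / (1 + t)) (convex_Ici 0) ?_ ?_ ?_
  · exact fun t ht => (hasDerivAt_omega (by linarith [mem_Ici.1 ht])).continuousAt.continuousWithinAt
  · intro t ht
    rw [interior_Ici, mem_Ioi] at ht
    exact (hasDerivAt_omega (by linarith)).hasDerivWithinAt
  · intro t ht
    rw [interior_Ici, mem_Ioi] at ht
    positivity

theorem strictMonoOn_omegaStar : StrictMonoOn omegaStar (Ico 0 1) := by
  refine strictMonoOn_of_hasDerivWithinAt_pos (f' := fun t => t / (1 - t)) (convex_Ico 0 1) ?_ ?_ ?_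
  · exact fun t ht => (hasDerivAt_omegaStar ht.2).continuousAt.continuousWithinAt
  · intro t ht
    rw [interior_Ico] at ht
    exact (hasDerivAt_omegaStar ht.2).hasDerivWithinAt
  · intro t ht
    rw [interior_Ico] at ht
    exact div_pos ht.1 (by linarith [ht.2])

theorem omega_pos {t : ℝ} (ht : 0 < t) : 0 < omega t := by
  simpa using strictMonoOn_omega (mem_Ici.2 le_rfl) (mem_Ici.2 ht.le) ht

theorem omega_nonneg {t : ℝ} (ht : 0 ≤ t) : 0 ≤ omega t := by
  simpa using strictMonoOn_omega.monotoneOn (mem_Ici.2 le_rfl) (mem_Ici.2 ht) ht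

theorem omegaStar_nonneg {t : ℝ} (ht : t ∈ Ico (0 : ℝ) 1) : 0 ≤ omegaStar t := by
  simpa using strictMonoOn_omegaStar.monotoneOn (by simp) ht ht.1

/-- The Fenchel–Young inequality for the conjugate pair `ω`, `ω_*`. -/
theorem mul_le_omega_add_omegaStar {l r : ℝ} (hr : 0 ≤ r) (hl : l < 1) :
    l * r ≤ omega r + omegaStar l := by
  have h1 : 0 < 1 + r := by linarith
  have h2 : 0 < 1 - l := by linarith
  -- log y ≤ y - 1 at y = (1 + r)(1 - l).
  have := Real.log_le_sub_one_of_pos (mul_pos h1 h2)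
  rw [Real.log_mul h1.ne' h2.ne'] at this
  unfold omega omegaStar
  nlinarith

/-- The damped step has local length l/(1+l) and linear decrease l²/(1+l); this identity makes its
net guaranteed decrease exactly ω(l). -/
theorem omegaStar_div_one_add {l : ℝ} (hl : 0 ≤ l) :
    omegaStar (l / (1 + l)) = l ^ 2 / (1 + l) - omega l := by
  have h1 : 0 < 1 + l := by linarith
  have h2 : 1 - l / (1 + l) = (1 + l)⁻¹ := by field_simp; ring
  unfold omegaStar omega
  rw [h2, Real.log_inv]
  field_simp
  ring

/-- The difference (1+t)ω(t) - (1-t)ω_*(t) vanishes at 0 and has derivative ω + ω_* ≥ 0. This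
converts the additive decrease ω into a fraction of the gap. -/
theorem mul_omegaStar_le_omega {t : ℝ} (ht : t ∈ Ico (0 : ℝ) 1) :
    (1 - t) / (1 + t) * omegaStar t ≤ omega t := by
  have mono : MonotoneOn (fun t => (1 + t) * omega t - (1 - t) * omegaStar t) (Ico 0 1) := by
    have hd : ∀ t ∈ Ico (0 : ℝ) 1, HasDerivAt
        (fun t => (1 + t) * omega t - (1 - t) * omegaStar t) (omega t + omegaStar t) t := by
      intro t ht
      have h1 : 1 + t ≠ 0 := by linarith [ht.1]
      have h2 : 1 - t ≠ 0 := by linarith [ht.2]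
      have := (((hasDerivAt_id t).const_add 1).mul (hasDerivAt_omega (by linarith [ht.1]))).sub
        (((hasDerivAt_id t).const_sub 1).mul (hasDerivAt_omegaStar ht.2))
      refine this.congr_deriv ?_
      simp only [id]
      field_simp
      ring
    refine monotoneOn_of_hasDerivWithinAt_nonneg (convex_Ico 0 1)
      (fun t ht => (hd t ht).continuousAt.continuousWithinAt)
      (fun t ht => (hd t (interior_subset ht)).hasDerivWithinAt)
      (fun t ht => add_nonneg (omega_nonneg (interior_subset ht).1)
        (omegaStar_nonneg (interior_subset ht)))
  have := mono (by simp) ht ht.1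
  simp only [omega_zero, omegaStar_zero, mul_zero, sub_zero] at this
  rw [div_mul_eq_mul_div, div_le_iff₀ (by linarith [ht.1])]
  linarith

theorem exists_omegaStar_eq {s : ℝ} (hs : 0 ≤ s) : ∃ t ∈ Ico (0 : ℝ) 1, omegaStar t = s := by
  -- Chosen so that ω_*(b) = s + exp(-(s+1)) ≥ s; the intermediate value theorem then applies on [0,
  -- b].
  set b := 1 - Real.exp (-(s + 1)) with hb
  have hb1 : b < 1 := by linarith [Real.exp_pos (-(s + 1))]
  have hb0 : 0 ≤ b := by
    have : Real.exp (-(s + 1)) ≤ 1 := Real.exp_le_one_iff.2 (by linarith)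
    linarith
  have hsb : s ≤ omegaStar b := by
    have : 1 - b = Real.exp (-(s + 1)) := by rw [hb]; ring
    rw [omegaStar, this, Real.log_exp]
    linarith
  have hc : ContinuousOn omegaStar (Icc 0 b) := fun t ht =>
    (hasDerivAt_omegaStar (ht.2.trans_lt hb1)).continuousAt.continuousWithinAt
  obtain ⟨t, ht, rfl⟩ := intermediate_value_Icc hb0 hc ⟨by simpa using hs, hsb⟩
  exact ⟨t, ⟨ht.1, ht.2.trans_lt hb1⟩, rfl⟩

theorem omegaStarInv_mem {s : ℝ} (hs : 0 ≤ s) : omegaStarInv s ∈ Ico (0 : ℝ) 1 :=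
  Function.invFunOn_mem (exists_omegaStar_eq hs)

theorem omegaStar_omegaStarInv {s : ℝ} (hs : 0 ≤ s) : omegaStar (omegaStarInv s) = s :=
  Function.invFunOn_eq (exists_omegaStar_eq hs)

end SelfConcordantMin

namespace SelfConcordantMin

/-! ### Symmetric trilinear forms -/

section Trilinear

variable {E : Type*} [NormedAddCommGroup E] [InnerProductSpace ℝ E]

/-- A symmetric trilinear form that is bounded on the diagonal by the cube of a Euclidean norm is
bounded by the product of the norms, for two equal arguments. -/
theorem abs_trilinear_le {H : E →L[ℝ] E} {S : E →L[ℝ] E →L[ℝ] E}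
    (hH : ∀ u v, ⟪u, H v⟫ = ⟪v, H u⟫) (hpos : ∀ u, u ≠ 0 → 0 < ⟪u, H u⟫)
    (hS : ∀ u v, S u v = S v u) (hS' : ∀ u v w, ⟪u, S v w⟫ = ⟪w, S v u⟫)
    {M : ℝ} (hM0 : 0 ≤ M) (hM : ∀ u, |⟪u, S u u⟫| ≤ M * ⟪u, H u⟫ ^ (3 / 2 : ℝ)) (u v : E) :
    |⟪u, S v u⟫| ≤ M * ⟪u, H u⟫ * √⟪v, H v⟫ := by
  have hnn : ∀ u, 0 ≤ ⟪u, H u⟫ := fun u => by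
    rcases eq_or_ne u 0 with rfl | hu
    · simp
    · exact (hpos u hu).le
  have hsq : ∀ u, √⟪u, H u⟫ ^ 2 = ⟪u, H u⟫ := fun u => Real.sq_sqrt (hnn u)
  rcases eq_or_ne u 0 with rfl | hu
  · simp
  rcases eq_or_ne v 0 with rfl | hv
  · simp
  have hρ : ∀ u, u ≠ 0 → 0 < √⟪u, H u⟫ := fun u hu => Real.sqrt_pos.2 (hpos u hu)
  obtain ⟨e, he1, hue⟩ : ∃ e : E, ⟪e, H e⟫ = 1 ∧ u = √⟪u, H u⟫ • e := by
    refine ⟨(√⟪u, H u⟫)⁻¹ • u, ?_, (smul_inv_smul₀ (hρ u hu).ne' u).symm⟩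
    have := (hρ u hu).ne'
    simp only [map_smul, inner_smul_left, inner_smul_right, conj_trivial]
    field_simp
    exact (hsq u).symm
  obtain ⟨w, hew, hvw⟩ : ∃ w : E, ⟪e, H w⟫ = 0 ∧ v = ⟪e, H v⟫ • e + w := by
    refine ⟨v - ⟪e, H v⟫ • e, ?_, by abel⟩
    simp [inner_sub_right, inner_smul_right, he1]
  -- If v is parallel to e, take e' = 0; hence only ⟨e', He'⟩ ≤ 1 is available. That suffices, since
  -- the form is only needed to be at most M on the unit circle of (e, e') coordinates.
  obtain ⟨e', he', hee', hwe'⟩ : ∃ e' : E, ⟪e', H e'⟫ ≤ 1 ∧ ⟪e, H e'⟫ = 0 ∧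
      w = √⟪w, H w⟫ • e' := by
    rcases eq_or_ne w 0 with rfl | hw
    · exact ⟨0, by simp, by simp, by simp⟩
    refine ⟨(√⟪w, H w⟫)⁻¹ • w, le_of_eq ?_, ?_, (smul_inv_smul₀ (hρ w hw).ne' w).symm⟩
    · have := (hρ w hw).ne'
      simp only [map_smul, inner_smul_left, inner_smul_right, conj_trivial]
      field_simp
      exact (hsq w).symm
    · simp [inner_smul_right, hew]
  have hwe : ⟪w, H e⟫ = 0 := by rw [hH, hew]
  have he'e : ⟪e', H e⟫ = 0 := by rw [hH, hee']
  have hvsq : ⟪v, H v⟫ = ⟪e, H v⟫ ^ 2 + ⟪w, H w⟫ := by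
    conv_lhs => rw [hvw]
    simp only [map_add, map_smul, inner_add_left, inner_add_right, inner_smul_left,
      inner_smul_right, conj_trivial, he1, hew, hwe]
    ring
  set g := ⟪e, H v⟫ with hg
  set r := √⟪v, H v⟫ with hr
  have hr0 : 0 < r := hρ v hv
  have hcs : (g / r) ^ 2 + (√⟪w, H w⟫ / r) ^ 2 = 1 := by
    field_simp
    rw [hsq, hsq, hvsq]
  have hpolar := abs_polar_cubic_le (A := ⟪e, S e e⟫) (B := ⟪e, S e' e⟫) (C := ⟪e', S e e'⟫)
    (D := ⟪e', S e' e'⟫) (M := M) ?_ hcs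
  · have hv' : ⟪u, S v u⟫ =
        ⟪u, H u⟫ * r * (⟪e, S e e⟫ * (g / r) + ⟪e, S e' e⟫ * (√⟪w, H w⟫ / r)) := by
      have h1 : ⟪u, S v u⟫ = ⟪u, H u⟫ * ⟪e, S v e⟫ := by
        have h2 : ⟪u, S v u⟫ = √⟪u, H u⟫ ^ 2 * ⟪e, S v e⟫ := by
          generalize √⟪u, H u⟫ = k at hue
          subst hue
          simp only [map_smul, inner_smul_left, inner_smul_right, conj_trivial]
          ring
        rw [h2, hsq]
      have h3 : ⟪e, S v e⟫ = g * ⟪e, S e e⟫ + √⟪w, H w⟫ * ⟪e, S e' e⟫ := by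
        have h4 : v = g • e + √⟪w, H w⟫ • e' := by rw [← hwe', ← hvw]
        generalize √⟪w, H w⟫ = k at h4
        clear_value g
        rw [h4]
        simp [inner_add_right, inner_smul_right]
      rw [h1, h3]
      field_simp
    rw [hv', abs_mul, abs_of_nonneg (mul_nonneg (hnn u) hr0.le)]
    nlinarith [mul_nonneg (hnn u) hr0.le]
  · intro a b hab
    have hq : ⟪a • e + b • e', H (a • e + b • e')⟫ ≤ 1 := by
      simp only [map_add, map_smul, inner_add_left, inner_add_right, inner_smul_left,
        inner_smul_right, conj_trivial, he1, hee', he'e]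
      nlinarith [sq_nonneg b]
    have h1 := hM (a • e + b • e')
    have h2 : M * ⟪a • e + b • e', H (a • e + b • e')⟫ ^ (3 / 2 : ℝ) ≤ M :=
      mul_le_of_le_one_right hM0 (Real.rpow_le_one (hnn _) hq (by norm_num))
    refine le_trans (le_of_eq ?_) (h1.trans h2)
    congr 1
    simp only [map_add, map_smul, inner_add_left, inner_add_right, inner_smul_left,
      inner_smul_right, conj_trivial, add_apply, smul_apply]
    have s1 : ⟪e, S e e'⟫ = ⟪e, S e' e⟫ := by rw [hS]
    have s2 : ⟪e', S e e⟫ = ⟪e, S e' e⟫ := by rw [hS', s1]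
    have s3 : ⟪e', S e' e⟫ = ⟪e', S e e'⟫ := by rw [hS]
    have s4 : ⟪e, S e' e'⟫ = ⟪e', S e e'⟫ := by rw [hS', s3]
    rw [s1, s2, s3, s4]
    ring

end Trilinear

/-! ### Derivatives of a self-concordant function -/

variable {N : ℕ} {f : EuclideanSpace ℝ (Fin N) → EReal}

theorem inner_gradient_realVal (x u : EuclideanSpace ℝ (Fin N)) :
    ⟪gradient (realVal f) x, u⟫ = fderiv ℝ (realVal f) x u := by
  rw [gradient, InnerProductSpace.toDual_symm_apply]

theorem IsSelfConcordant.contDiffAt_realVal {M : ℝ} (hf : IsSelfConcordant M f)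
    {x : EuclideanSpace ℝ (Fin N)} (hx : x ∈ dom f) : ContDiffAt ℝ 3 (realVal f) x :=
  hf.contDiff.contDiffAt (hf.isOpen_dom.mem_nhds hx)

theorem IsSelfConcordant.contDiffAt_gradient {M : ℝ} (hf : IsSelfConcordant M f)
    {x : EuclideanSpace ℝ (Fin N)} (hx : x ∈ dom f) :
    ContDiffAt ℝ 2 (gradient (realVal f)) x := by
  have h : ContDiffAt ℝ 2 (fderiv ℝ (realVal f)) x :=
    (hf.contDiffAt_realVal hx).fderiv_right (by norm_num)
  rw [contDiffAt_euclidean]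
  intro i
  have : (fun y => gradient (realVal f) y i) =
      fun y => fderiv ℝ (realVal f) y (EuclideanSpace.single i 1) := by
    funext y
    rw [← inner_gradient_realVal, EuclideanSpace.inner_single_right]
    simp
  rw [this]
  exact h.clm_apply contDiffAt_const

theorem IsSelfConcordant.contDiffAt_hessian {M : ℝ} (hf : IsSelfConcordant M f)
    {x : EuclideanSpace ℝ (Fin N)} (hx : x ∈ dom f) : ContDiffAt ℝ 1 (hessian f) x :=
  (hf.contDiffAt_gradient hx).fderiv_right (by norm_num)

theorem hasDerivAt_line (x v : EuclideanSpace ℝ (Fin N)) (t : ℝ) :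
    HasDerivAt (fun t : ℝ => x + t • v) v t := by
  simpa using ((hasDerivAt_id t).smul_const v).const_add x

section Line

variable {M : ℝ} {x v : EuclideanSpace ℝ (Fin N)} {t : ℝ}

theorem IsSelfConcordant.hasDerivAt_realVal_line (hf : IsSelfConcordant M f)
    (hx : x + t • v ∈ dom f) :
    HasDerivAt (fun t : ℝ => realVal f (x + t • v)) ⟪gradient (realVal f) (x + t • v), v⟫ t := by
  rw [inner_gradient_realVal]
  exact ((hf.contDiffAt_realVal hx).differentiableAt (by norm_num)).hasFDerivAt.comp_hasDerivAt t
    (hasDerivAt_line x v t)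

theorem IsSelfConcordant.hasDerivAt_gradient_line (hf : IsSelfConcordant M f)
    (hx : x + t • v ∈ dom f) (u : EuclideanSpace ℝ (Fin N)) :
    HasDerivAt (fun t : ℝ => ⟪gradient (realVal f) (x + t • v), u⟫)
      ⟪u, hessian f (x + t • v) v⟫ t := by
  have h := ((hf.contDiffAt_gradient hx).differentiableAt
    (by norm_num)).hasFDerivAt.comp_hasDerivAt t (hasDerivAt_line x v t)
  refine (h.inner ℝ (hasDerivAt_const t u)).congr_deriv ?_
  rw [inner_zero_right, zero_add, real_inner_comm]
  rfl

theorem IsSelfConcordant.hasDerivAt_hessian_line (hf : IsSelfConcordant M f)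
    (hx : x + t • v ∈ dom f) (u w : EuclideanSpace ℝ (Fin N)) :
    HasDerivAt (fun t : ℝ => ⟪u, hessian f (x + t • v) w⟫)
      ⟪u, fderiv ℝ (hessian f) (x + t • v) v w⟫ t := by
  have h := ((hf.contDiffAt_hessian hx).differentiableAt
    (by norm_num)).hasFDerivAt.comp_hasDerivAt t (hasDerivAt_line x v t)
  have h' := h.clm_apply (hasDerivAt_const t w)
  simpa using (hasDerivAt_const t u).inner ℝ h'

end Line

/-- Differentiating the gradient along a line identifies this Hessian with the second Fréchet
derivative, which is symmetric for C³ functions. -/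
theorem IsSelfConcordant.hessian_symm {M : ℝ} (hf : IsSelfConcordant M f)
    {x : EuclideanSpace ℝ (Fin N)} (hx : x ∈ dom f) (u v : EuclideanSpace ℝ (Fin N)) :
    ⟪u, hessian f x v⟫ = ⟪v, hessian f x u⟫ := by
  have hsymm : IsSymmSndFDerivAt ℝ (realVal f) x :=
    (hf.contDiffAt_realVal hx).isSymmSndFDerivAt (by simp; norm_num)
  have hd : DifferentiableAt ℝ (fderiv ℝ (realVal f)) x :=
    ((hf.contDiffAt_realVal hx).fderiv_right (m := 2) (by norm_num)).differentiableAt (by norm_num)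
  have key : ∀ u v, ⟪u, hessian f x v⟫ = fderiv ℝ (fderiv ℝ (realVal f)) x v u := by
    intro u v
    have h0 : x + (0 : ℝ) • v = x := by simp
    have h1 := hf.hasDerivAt_gradient_line (x := x) (v := v) (t := 0) (by rwa [h0]) u
    have h2 : HasDerivAt (fun t : ℝ => fderiv ℝ (realVal f) (x + t • v) u)
        (fderiv ℝ (fderiv ℝ (realVal f)) (x + (0 : ℝ) • v) v u) 0 := by
      have := (show DifferentiableAt ℝ (fderiv ℝ (realVal f)) (x + (0 : ℝ) • v) by
        rwa [h0]).hasFDerivAt.comp_hasDerivAt 0 (hasDerivAt_line x v 0)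
      simpa using this.clm_apply (hasDerivAt_const 0 u)
    simp only [inner_gradient_realVal] at h1
    have := h1.unique h2
    rwa [h0] at this
  rw [key, key, hsymm]

theorem IsSelfConcordant.third_symm_left {M : ℝ} (hf : IsSelfConcordant M f)
    {x : EuclideanSpace ℝ (Fin N)} (hx : x ∈ dom f) (u v : EuclideanSpace ℝ (Fin N)) :
    fderiv ℝ (hessian f) x u v = fderiv ℝ (hessian f) x v u :=
  (hf.contDiffAt_gradient hx).isSymmSndFDerivAt (by simp) u v

theorem IsSelfConcordant.eventually_line_mem {M : ℝ} (hf : IsSelfConcordant M f)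
    {x : EuclideanSpace ℝ (Fin N)} (hx : x ∈ dom f) (v : EuclideanSpace ℝ (Fin N)) :
    ∀ᶠ t : ℝ in nhds 0, x + t • v ∈ dom f :=
  (hasDerivAt_line x v 0).continuousAt.eventually_mem
    (hf.isOpen_dom.mem_nhds (by simpa using hx))

/-- Symmetry of the Hessian holds near x because the domain is open, so it can be differentiated
along a line. -/
theorem IsSelfConcordant.third_symm_right {M : ℝ} (hf : IsSelfConcordant M f)
    {x : EuclideanSpace ℝ (Fin N)} (hx : x ∈ dom f) (u v w : EuclideanSpace ℝ (Fin N)) :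
    ⟪u, fderiv ℝ (hessian f) x v w⟫ = ⟪w, fderiv ℝ (hessian f) x v u⟫ := by
  have h0 : x + (0 : ℝ) • v = x := by simp
  have h1 := hf.hasDerivAt_hessian_line (x := x) (v := v) (t := 0) (by rwa [h0]) u w
  have h2 := hf.hasDerivAt_hessian_line (x := x) (v := v) (t := 0) (by rwa [h0]) w u
  have h3 := h2.congr_of_eventuallyEq (f₁ := fun t : ℝ => ⟪u, hessian f (x + t • v) w⟫)
    ((hf.eventually_line_mem hx v).mono fun t ht => hf.hessian_symm ht u w)
  have := h1.unique h3
  rwa [h0] at this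

theorem IsSelfConcordant.iteratedDeriv_two {M : ℝ} (hf : IsSelfConcordant M f)
    {x : EuclideanSpace ℝ (Fin N)} (hx : x ∈ dom f) (u : EuclideanSpace ℝ (Fin N)) :
    iteratedDeriv 2 (fun t : ℝ => realVal f (x + t • u)) =ᶠ[nhds 0]
      fun t : ℝ => ⟪u, hessian f (x + t • u) u⟫ := by
  have h1 : deriv (fun t : ℝ => realVal f (x + t • u)) =ᶠ[nhds 0]
      fun t => ⟪gradient (realVal f) (x + t • u), u⟫ :=
    (hf.eventually_line_mem hx u).mono fun t ht => (hf.hasDerivAt_realVal_line ht).deriv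
  have h2 : deriv (fun t : ℝ => ⟪gradient (realVal f) (x + t • u), u⟫) =ᶠ[nhds 0]
      fun t => ⟪u, hessian f (x + t • u) u⟫ :=
    (hf.eventually_line_mem hx u).mono fun t ht => (hf.hasDerivAt_gradient_line ht u).deriv
  rw [iteratedDeriv_succ, iteratedDeriv_one]
  exact h1.deriv.trans h2

theorem IsSelfConcordant.iteratedDeriv_three {M : ℝ} (hf : IsSelfConcordant M f)
    {x : EuclideanSpace ℝ (Fin N)} (hx : x ∈ dom f) (u : EuclideanSpace ℝ (Fin N)) :
    iteratedDeriv 3 (fun t : ℝ => realVal f (x + t • u)) 0 =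
      ⟪u, fderiv ℝ (hessian f) x u u⟫ := by
  have h0 : x + (0 : ℝ) • u = x := by simp
  rw [iteratedDeriv_succ, (hf.iteratedDeriv_two hx u).deriv_eq,
    (hf.hasDerivAt_hessian_line (by rwa [h0]) u u).deriv, h0]

/-- Self-concordance is the case u = v; polarization keeps the same constant M. -/
theorem IsSelfConcordant.abs_third_le {M : ℝ} (hf : IsSelfConcordant M f)
    {x : EuclideanSpace ℝ (Fin N)} (hx : x ∈ dom f)
    (hpos : ∀ u : EuclideanSpace ℝ (Fin N), u ≠ 0 → 0 < ⟪u, hessian f x u⟫)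
    (u v : EuclideanSpace ℝ (Fin N)) :
    |⟪u, fderiv ℝ (hessian f) x v u⟫| ≤ M * ⟪u, hessian f x u⟫ * localNorm f x v := by
  refine abs_trilinear_le (hf.hessian_symm hx) hpos (hf.third_symm_left hx)
    (hf.third_symm_right hx) hf.nonneg (fun u => ?_) u v
  have := hf.third_deriv_le x hx u
  rwa [hf.iteratedDeriv_three hx, (hf.iteratedDeriv_two hx u).eq_of_nhds, zero_smul,
    add_zero] at this

end SelfConcordantMin

namespace SelfConcordantMin

variable {N : ℕ} {f : EuclideanSpace ℝ (Fin N) → EReal}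

/-! ### Local norms -/

/-- The Hessian of `f` is positive definite at every point of `dom f`. -/
def HessianPosDef (f : EuclideanSpace ℝ (Fin N) → EReal) : Prop :=
  ∀ x ∈ dom f, ∀ u : EuclideanSpace ℝ (Fin N), u ≠ 0 → 0 < ⟪u, hessian f x u⟫

theorem localNorm_nonneg (x u : EuclideanSpace ℝ (Fin N)) : 0 ≤ localNorm f x u :=
  Real.sqrt_nonneg _

@[simp] theorem localNorm_zero (x : EuclideanSpace ℝ (Fin N)) : localNorm f x 0 = 0 := by
  simp [localNorm]

theorem localNorm_smul (c : ℝ) (x u : EuclideanSpace ℝ (Fin N)) :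
    localNorm f x (c • u) = |c| * localNorm f x u := by
  rw [localNorm, localNorm, ← Real.sqrt_sq_eq_abs, ← Real.sqrt_mul (sq_nonneg c)]
  simp only [map_smul, inner_smul_left, inner_smul_right, conj_trivial]
  ring_nf

theorem localNorm_neg (x u : EuclideanSpace ℝ (Fin N)) :
    localNorm f x (-u) = localNorm f x u := by
  simp [localNorm]

theorem HessianPosDef.inner_nonneg (hpos : HessianPosDef f) {x : EuclideanSpace ℝ (Fin N)}
    (hx : x ∈ dom f) (u : EuclideanSpace ℝ (Fin N)) : 0 ≤ ⟪u, hessian f x u⟫ := by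
  rcases eq_or_ne u 0 with rfl | hu
  · simp
  · exact (hpos x hx u hu).le

theorem HessianPosDef.localNorm_sq (hpos : HessianPosDef f) {x : EuclideanSpace ℝ (Fin N)}
    (hx : x ∈ dom f) (u : EuclideanSpace ℝ (Fin N)) :
    localNorm f x u ^ 2 = ⟪u, hessian f x u⟫ :=
  Real.sq_sqrt (hpos.inner_nonneg hx u)

theorem HessianPosDef.localNorm_pos (hpos : HessianPosDef f) {x : EuclideanSpace ℝ (Fin N)}
    (hx : x ∈ dom f) {u : EuclideanSpace ℝ (Fin N)} (hu : u ≠ 0) : 0 < localNorm f x u :=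
  Real.sqrt_pos.2 (hpos x hx u hu)

/-- The Cauchy–Schwarz inequality for the local inner product. -/
theorem HessianPosDef.inner_hessian_le {M : ℝ} (hf : IsSelfConcordant M f)
    (hpos : HessianPosDef f) {x : EuclideanSpace ℝ (Fin N)} (hx : x ∈ dom f)
    (u v : EuclideanSpace ℝ (Fin N)) :
    ⟪u, hessian f x v⟫ ≤ localNorm f x u * localNorm f x v := by
  rcases eq_or_ne u 0 with rfl | hu
  · simp
  rcases eq_or_ne v 0 with rfl | hv
  · simp
  have hu0 := hpos.localNorm_pos hx hu
  have hv0 := hpos.localNorm_pos hx hv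
  have hu2 := hpos.localNorm_sq hx u
  have hv2 := hpos.localNorm_sq hx v
  -- Nonnegativity of the quadratic form at ‖v‖u - ‖u‖v is Cauchy–Schwarz after expansion.
  have h := hpos.inner_nonneg hx (localNorm f x v • u - localNorm f x u • v)
  simp only [map_sub, map_smul, inner_sub_left, inner_sub_right, inner_smul_left,
    inner_smul_right, conj_trivial, ← hu2, ← hv2, hf.hessian_symm hx v u] at h
  have : 0 ≤ 2 * (localNorm f x u * localNorm f x v) *
      (localNorm f x u * localNorm f x v - ⟪u, hessian f x v⟫) := by nlinarith
  have := nonneg_of_mul_nonneg_right this (by positivity)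
  linarith

/-! ### Estimates along a segment in the domain -/

section Segment

variable {x v : EuclideanSpace ℝ (Fin N)}

/-- With ψ(t) = f(x + tv), the function ψ''(t)^(-1/2) has derivative -ψ'''/(2ψ''^(3/2)). The
self-concordance constant 2 makes this at most 1 in absolute value. -/
theorem abs_inv_localNorm_sub_le (hf : IsStandardSelfConcordant f) (hpos : HessianPosDef f)
    (hseg : ∀ t ∈ Icc (0 : ℝ) 1, x + t • v ∈ dom f) (hv : v ≠ 0) {t : ℝ}
    (ht : t ∈ Icc (0 : ℝ) 1) :
    |(localNorm f (x + t • v) v)⁻¹ - (localNorm f x v)⁻¹| ≤ t := by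
  have hd : ∀ t ∈ Icc (0 : ℝ) 1, HasDerivWithinAt (fun t : ℝ => (localNorm f (x + t • v) v)⁻¹)
      (-(⟪v, fderiv ℝ (hessian f) (x + t • v) v v⟫ / (2 * localNorm f (x + t • v) v)) /
        localNorm f (x + t • v) v ^ 2) (Icc 0 1) t := fun t ht =>
    (((hf.hasDerivAt_hessian_line (hseg t ht) v v).sqrt
      (hpos _ (hseg t ht) v hv).ne').inv (hpos.localNorm_pos (hseg t ht) hv).ne').hasDerivWithinAt
  have hb : ∀ t ∈ Icc (0 : ℝ) 1,
      ‖-(⟪v, fderiv ℝ (hessian f) (x + t • v) v v⟫ / (2 * localNorm f (x + t • v) v)) /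
        localNorm f (x + t • v) v ^ 2‖ ≤ 1 := by
    intro t ht
    have h := hf.abs_third_le (hseg t ht) (hpos _ (hseg t ht)) v v
    have h0 := hpos.localNorm_pos (hseg t ht) hv
    rw [← hpos.localNorm_sq (hseg t ht)] at h
    rw [Real.norm_eq_abs, abs_div, abs_neg, abs_div, abs_of_pos (pow_pos h0 2),
      abs_of_pos (mul_pos two_pos h0), div_div, div_le_one (by positivity)]
    linarith
  have := Convex.norm_image_sub_le_of_norm_hasDerivWithin_le hd hb (convex_Icc 0 1)
    (left_mem_Icc.2 zero_le_one) ht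
  simpa [abs_of_nonneg ht.1] using this

theorem localNorm_line_le (hf : IsStandardSelfConcordant f) (hpos : HessianPosDef f)
    (hseg : ∀ t ∈ Icc (0 : ℝ) 1, x + t • v ∈ dom f) (hr : localNorm f x v < 1) {t : ℝ}
    (ht : t ∈ Icc (0 : ℝ) 1) :
    localNorm f (x + t • v) v ≤ localNorm f x v / (1 - localNorm f x v * t) := by
  rcases eq_or_ne v 0 with rfl | hv
  · simp
  have h := (abs_le.1 (abs_inv_localNorm_sub_le hf hpos hseg hv ht)).1
  have hx : x ∈ dom f := by simpa using hseg 0 (by simp)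
  have h0 := hpos.localNorm_pos hx hv
  have h1 := hpos.localNorm_pos (hseg t ht) hv
  set r := localNorm f x v
  set ρ := localNorm f (x + t • v) v
  have h2 : 0 < 1 - r * t := by nlinarith [ht.1, ht.2]
  have h3 : (1 - r * t) / r ≤ ρ⁻¹ := by
    have : (1 - r * t) / r = r⁻¹ - t := by field_simp
    linarith
  rw [← inv_inv ρ, ← inv_div]
  exact inv_anti₀ (by positivity) h3

theorem le_localNorm_line (hf : IsStandardSelfConcordant f) (hpos : HessianPosDef f)
    (hseg : ∀ t ∈ Icc (0 : ℝ) 1, x + t • v ∈ dom f) {t : ℝ} (ht : t ∈ Icc (0 : ℝ) 1) :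
    localNorm f x v / (1 + localNorm f x v * t) ≤ localNorm f (x + t • v) v := by
  rcases eq_or_ne v 0 with rfl | hv
  · simp
  have h := (abs_le.1 (abs_inv_localNorm_sub_le hf hpos hseg hv ht)).2
  have hx : x ∈ dom f := by simpa using hseg 0 (by simp)
  have h0 := hpos.localNorm_pos hx hv
  have h1 := hpos.localNorm_pos (hseg t ht) hv
  set r := localNorm f x v
  set ρ := localNorm f (x + t • v) v
  have h3 : ρ⁻¹ ≤ (1 + r * t) / r := by
    have : (1 + r * t) / r = r⁻¹ + t := by field_simp
    linarith
  rw [← inv_inv ρ, ← inv_div]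
  exact inv_anti₀ (by positivity) h3

/-- A differential inequality for ⟨u, ∇²f(x+tv)u⟩: its logarithmic derivative is at most 2r/(1-rt).
Integrated, it gives the two-sided comparison of local norms in the next two lemmas. -/
theorem abs_third_line_le (hf : IsStandardSelfConcordant f) (hpos : HessianPosDef f)
    (hseg : ∀ t ∈ Icc (0 : ℝ) 1, x + t • v ∈ dom f) (hr : localNorm f x v < 1)
    (u : EuclideanSpace ℝ (Fin N)) {t : ℝ} (ht : t ∈ Icc (0 : ℝ) 1) :
    |⟪u, fderiv ℝ (hessian f) (x + t • v) v u⟫| * (1 - localNorm f x v * t) ≤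
      2 * localNorm f x v * ⟪u, hessian f (x + t • v) u⟫ := by
  have h := hf.abs_third_le (hseg t ht) (hpos _ (hseg t ht)) u v
  have h1 := localNorm_line_le hf hpos hseg hr ht
  have h0 := localNorm_nonneg (f := f) x v
  have h2 : 0 < 1 - localNorm f x v * t := by nlinarith [ht.1, ht.2]
  have hq := hpos.inner_nonneg (hseg t ht) u
  rw [le_div_iff₀ h2] at h1
  calc _ ≤ 2 * ⟪u, hessian f (x + t • v) u⟫ * localNorm f (x + t • v) v *
        (1 - localNorm f x v * t) := mul_le_mul_of_nonneg_right h h2.le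
    _ = 2 * ⟪u, hessian f (x + t • v) u⟫ *
        (localNorm f (x + t • v) v * (1 - localNorm f x v * t)) := by ring
    _ ≤ 2 * ⟪u, hessian f (x + t • v) u⟫ * localNorm f x v :=
        mul_le_mul_of_nonneg_left h1 (by positivity)
    _ = _ := by ring

theorem localNorm_line_mul_le (hf : IsStandardSelfConcordant f) (hpos : HessianPosDef f)
    (hseg : ∀ t ∈ Icc (0 : ℝ) 1, x + t • v ∈ dom f) (hr : localNorm f x v < 1)
    (u : EuclideanSpace ℝ (Fin N)) {t : ℝ} (ht : t ∈ Icc (0 : ℝ) 1) :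
    localNorm f (x + t • v) u * (1 - localNorm f x v * t) ≤ localNorm f x u := by
  have hx : x ∈ dom f := by simpa using hseg 0 (by simp)
  have h0 := localNorm_nonneg (f := f) x v
  set r := localNorm f x v with hrdef
  have h2 : ∀ t ∈ Icc (0 : ℝ) 1, 0 < 1 - r * t := fun t ht => by nlinarith [ht.1, ht.2]
  have hd : ∀ t ∈ Icc (0 : ℝ) 1,
      HasDerivAt (fun t => ⟪u, hessian f (x + t • v) u⟫ * (1 - r * t) ^ 2)
        (⟪u, fderiv ℝ (hessian f) (x + t • v) v u⟫ * (1 - r * t) ^ 2 -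
          ⟪u, hessian f (x + t • v) u⟫ * (2 * r * (1 - r * t))) t := by
    intro t ht
    have h := (hf.hasDerivAt_hessian_line (hseg t ht) u u).mul
      ((((hasDerivAt_id t).const_mul r).const_sub 1).pow 2)
    refine h.congr_deriv ?_
    simp
    ring
  have anti : AntitoneOn (fun t => ⟪u, hessian f (x + t • v) u⟫ * (1 - r * t) ^ 2) (Icc 0 1) := by
    refine antitoneOn_of_hasDerivWithinAt_nonpos (convex_Icc 0 1)
      (fun t ht => (hd t ht).continuousAt.continuousWithinAt)
      (fun t ht => (hd t (interior_subset ht)).hasDerivWithinAt) fun t ht => ?_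
    have ht := interior_subset ht
    have h3 := abs_third_line_le hf hpos hseg hr u ht
    have h4 := mul_le_mul_of_nonneg_right (le_abs_self
      ⟪u, fderiv ℝ (hessian f) (x + t • v) v u⟫) (h2 t ht).le
    nlinarith [h2 t ht]
  have h5 := anti (left_mem_Icc.2 zero_le_one) ht ht.1
  simp only [zero_smul, add_zero, mul_zero, sub_zero, one_pow, mul_one] at h5
  rw [← hpos.localNorm_sq hx, ← hpos.localNorm_sq (hseg t ht), ← mul_pow] at h5
  exact le_of_sq_le_sq h5 (localNorm_nonneg x u)

theorem mul_localNorm_le_line (hf : IsStandardSelfConcordant f) (hpos : HessianPosDef f)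
    (hseg : ∀ t ∈ Icc (0 : ℝ) 1, x + t • v ∈ dom f) (hr : localNorm f x v < 1)
    (u : EuclideanSpace ℝ (Fin N)) {t : ℝ} (ht : t ∈ Icc (0 : ℝ) 1) :
    localNorm f x u * (1 - localNorm f x v * t) ≤ localNorm f (x + t • v) u := by
  have hx : x ∈ dom f := by simpa using hseg 0 (by simp)
  have h0 := localNorm_nonneg (f := f) x v
  set r := localNorm f x v with hrdef
  have h2 : ∀ t ∈ Icc (0 : ℝ) 1, 0 < 1 - r * t := fun t ht => by nlinarith [ht.1, ht.2]
  have hd : ∀ t ∈ Icc (0 : ℝ) 1,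
      HasDerivAt (fun t => ⟪u, hessian f (x + t • v) u⟫ / (1 - r * t) ^ 2)
        ((⟪u, fderiv ℝ (hessian f) (x + t • v) v u⟫ * (1 - r * t) ^ 2 +
          ⟪u, hessian f (x + t • v) u⟫ * (2 * r * (1 - r * t))) / ((1 - r * t) ^ 2) ^ 2) t := by
    intro t ht
    have h := (hf.hasDerivAt_hessian_line (hseg t ht) u u).div
      ((((hasDerivAt_id t).const_mul r).const_sub 1).pow 2) (pow_pos (h2 t ht) 2).ne'
    refine h.congr_deriv ?_
    simp
    ring
  have mono : MonotoneOn (fun t => ⟪u, hessian f (x + t • v) u⟫ / (1 - r * t) ^ 2) (Icc 0 1) := by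
    refine monotoneOn_of_hasDerivWithinAt_nonneg (convex_Icc 0 1)
      (fun t ht => (hd t ht).continuousAt.continuousWithinAt)
      (fun t ht => (hd t (interior_subset ht)).hasDerivWithinAt) fun t ht => ?_
    have ht := interior_subset ht
    have h3 := abs_third_line_le hf hpos hseg hr u ht
    have h4 := mul_le_mul_of_nonneg_right (neg_abs_le
      ⟪u, fderiv ℝ (hessian f) (x + t • v) v u⟫) (h2 t ht).le
    refine div_nonneg ?_ (by positivity)
    nlinarith [h2 t ht]
  have h5 := mono (left_mem_Icc.2 zero_le_one) ht ht.1
  simp only [zero_smul, add_zero, mul_zero, sub_zero, one_pow, div_one] at h5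
  rw [le_div_iff₀ (pow_pos (h2 t ht) 2), ← hpos.localNorm_sq hx,
    ← hpos.localNorm_sq (hseg t ht), ← mul_pow] at h5
  exact le_of_sq_le_sq h5 (localNorm_nonneg _ u)

/-- ψ''(t) ≤ r²/(1-rt)², which is the second derivative of ω_*(rt). -/
theorem realVal_add_le_of_segment (hf : IsStandardSelfConcordant f) (hpos : HessianPosDef f)
    (hseg : ∀ t ∈ Icc (0 : ℝ) 1, x + t • v ∈ dom f) (hr : localNorm f x v < 1) :
    realVal f (x + v) ≤
      realVal f x + ⟪gradient (realVal f) x, v⟫ + omegaStar (localNorm f x v) := by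
  have h0 := localNorm_nonneg (f := f) x v
  set r := localNorm f x v with hrdef
  set g := ⟪gradient (realVal f) x, v⟫ with hg
  have h2 : ∀ t ∈ Icc (0 : ℝ) 1, 0 < 1 - r * t := fun t ht => by nlinarith [ht.1, ht.2]
  have key := image_one_le_of_second_deriv_nonpos
    (h := fun t : ℝ => realVal f (x + t • v) - t * g - omegaStar (r * t))
    (h₁ := fun t : ℝ => ⟪gradient (realVal f) (x + t • v), v⟫ - g - r * t / (1 - r * t) * r)
    (h₂ := fun t : ℝ => ⟪v, hessian f (x + t • v) v⟫ - r ^ 2 / (1 - r * t) ^ 2) ?_ ?_ ?_ ?_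
  · simp only [one_smul, one_mul, mul_one, zero_smul, add_zero, zero_mul, mul_zero,
      omegaStar_zero, sub_zero] at key
    linarith
  · intro t ht
    have hω := (hasDerivAt_omegaStar (sub_pos.1 (h2 t ht))).comp t ((hasDerivAt_id t).const_mul r)
    refine (((hf.hasDerivAt_realVal_line (hseg t ht)).sub
      ((hasDerivAt_id t).mul_const g)).sub hω).congr_deriv ?_
    simp
  · intro t ht
    have hn := (h2 t ht).ne'
    have hq := (((hasDerivAt_id t).const_mul r).div
      (((hasDerivAt_id t).const_mul r).const_sub 1) hn).mul_const r
    refine (((hf.hasDerivAt_gradient_line (hseg t ht) v).sub_const g).sub hq).congr_deriv ?_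
    simp only [id]
    field_simp
    ring
  · intro t ht
    have := localNorm_line_le hf hpos hseg hr ht
    rw [← hpos.localNorm_sq (hseg t ht), ← div_pow]
    have := pow_le_pow_left₀ (localNorm_nonneg _ _) this 2
    linarith
  · simp [hg]

/-- ψ''(t) ≥ r²/(1+rt)², which is the second derivative of ω(rt); no restriction on r is needed. -/
theorem le_realVal_add_of_segment (hf : IsStandardSelfConcordant f) (hpos : HessianPosDef f)
    (hseg : ∀ t ∈ Icc (0 : ℝ) 1, x + t • v ∈ dom f) :
    realVal f x + ⟪gradient (realVal f) x, v⟫ + omega (localNorm f x v) ≤ realVal f (x + v) := by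
  have h0 := localNorm_nonneg (f := f) x v
  set r := localNorm f x v with hrdef
  set g := ⟪gradient (realVal f) x, v⟫ with hg
  have h2 : ∀ t ∈ Icc (0 : ℝ) 1, 0 < 1 + r * t := fun t ht => by nlinarith [ht.1, ht.2]
  have key := image_one_le_of_second_deriv_nonpos
    (h := fun t : ℝ => omega (r * t) + t * g - realVal f (x + t • v))
    (h₁ := fun t : ℝ => r * t / (1 + r * t) * r + g - ⟪gradient (realVal f) (x + t • v), v⟫)
    (h₂ := fun t : ℝ => r ^ 2 / (1 + r * t) ^ 2 - ⟪v, hessian f (x + t • v) v⟫) ?_ ?_ ?_ ?_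
  · simp only [one_smul, one_mul, mul_one, zero_smul, add_zero, zero_mul, mul_zero,
      omega_zero] at key
    linarith
  · intro t ht
    have hω := (hasDerivAt_omega (neg_lt_iff_pos_add'.2 (h2 t ht))).comp t
      ((hasDerivAt_id t).const_mul r)
    refine ((hω.add ((hasDerivAt_id t).mul_const g)).sub
      (hf.hasDerivAt_realVal_line (hseg t ht))).congr_deriv ?_
    simp
  · intro t ht
    have hn := (h2 t ht).ne'
    have hq := (((hasDerivAt_id t).const_mul r).div
      (((hasDerivAt_id t).const_mul r).const_add 1) hn).mul_const r
    refine ((hq.add_const g).sub (hf.hasDerivAt_gradient_line (hseg t ht) v)).congr_deriv ?_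
    simp only [id]
    field_simp
    ring
  · intro t ht
    have := le_localNorm_line hf hpos hseg ht
    rw [← hpos.localNorm_sq (hseg t ht), ← div_pow]
    have := pow_le_pow_left₀ (div_nonneg h0 (h2 t ht).le) this 2
    linarith
  · simp [hg]

/-- The error of linearizing the gradient: ∇³f[u,v,v] is at most 2r²s/(1-rt)³ at x + tv, and this is
integrated twice in t. -/
theorem inner_gradient_add_le_of_segment (hf : IsStandardSelfConcordant f)
    (hpos : HessianPosDef f) (hseg : ∀ t ∈ Icc (0 : ℝ) 1, x + t • v ∈ dom f)
    (hr : localNorm f x v < 1) (u : EuclideanSpace ℝ (Fin N)) :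
    ⟪gradient (realVal f) (x + v), u⟫ ≤ ⟪gradient (realVal f) x, u⟫ + ⟪u, hessian f x v⟫ +
      localNorm f x v ^ 2 / (1 - localNorm f x v) * localNorm f x u := by
  have h0 := localNorm_nonneg (f := f) x v
  have hu0 := localNorm_nonneg (f := f) x u
  set r := localNorm f x v with hrdef
  set s := localNorm f x u with hs
  set g := ⟪u, hessian f x v⟫ with hg
  have h2 : ∀ t ∈ Icc (0 : ℝ) 1, 0 < 1 - r * t := fun t ht => by nlinarith [ht.1, ht.2]
  have key := image_one_le_of_second_deriv_nonpos
    (h := fun t : ℝ => ⟪gradient (realVal f) (x + t • v), u⟫ - t * g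
      - s * ((1 - r * t)⁻¹ - r * t))
    (h₁ := fun t : ℝ => ⟪u, hessian f (x + t • v) v⟫ - g - s * (r / (1 - r * t) ^ 2 - r))
    (h₂ := fun t : ℝ => ⟪u, fderiv ℝ (hessian f) (x + t • v) v v⟫ -
      s * (2 * r ^ 2 / (1 - r * t) ^ 3)) ?_ ?_ ?_ ?_
  · simp only [one_smul, one_mul, mul_one, zero_smul, add_zero, zero_mul, mul_zero, sub_zero,
      inv_one] at key
    have h3 : 1 - r ≠ 0 := by linarith
    have h4 : r ^ 2 / (1 - r) * s = s * ((1 - r)⁻¹ - r) - s := by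
      field_simp
      ring
    linarith
  · intro t ht
    have hn := (h2 t ht).ne'
    have hq := (((((hasDerivAt_id t).const_mul r).const_sub 1).inv hn).sub
      ((hasDerivAt_id t).const_mul r)).const_mul s
    refine (((hf.hasDerivAt_gradient_line (hseg t ht) u).sub
      ((hasDerivAt_id t).mul_const g)).sub hq).congr_deriv ?_
    simp
  · intro t ht
    have hn := (h2 t ht).ne'
    have hq := (((hasDerivAt_const t r).div
      ((((hasDerivAt_id t).const_mul r).const_sub 1).pow 2) (pow_ne_zero 2 hn)).sub_const
        r).const_mul s
    refine (((hf.hasDerivAt_hessian_line (hseg t ht) u v).sub_const g).sub hq).congr_deriv ?_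
    simp only [Pi.pow_apply, id]
    field_simp
    simp
    ring
  · intro t ht
    have hy := hseg t ht
    have h3 := h2 t ht
    have e : ⟪u, fderiv ℝ (hessian f) (x + t • v) v v⟫ =
        ⟪v, fderiv ℝ (hessian f) (x + t • v) u v⟫ := by
      rw [hf.third_symm_right hy, hf.third_symm_left hy]
    have hb := (le_abs_self _).trans (hf.abs_third_le hy (hpos _ hy) v u)
    rw [← hpos.localNorm_sq hy] at hb
    have hv := localNorm_line_le hf hpos hseg hr ht
    have hu := localNorm_line_mul_le hf hpos hseg hr u ht
    rw [← le_div_iff₀ h3] at hu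
    rw [e, sub_nonpos]
    refine hb.trans ?_
    calc 2 * localNorm f (x + t • v) v ^ 2 * localNorm f (x + t • v) u
        ≤ 2 * (r / (1 - r * t)) ^ 2 * (s / (1 - r * t)) := by
          have := localNorm_nonneg (f := f) (x + t • v) v
          have := localNorm_nonneg (f := f) (x + t • v) u
          gcongr
      _ = _ := by field_simp
  · simp [hg]

theorem IsSelfConcordant.segment_mem {M : ℝ} (hf : IsSelfConcordant M f) (hx : x ∈ dom f)
    (hxv : x + v ∈ dom f) : ∀ t ∈ Icc (0 : ℝ) 1, x + t • v ∈ dom f := fun t ht => by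
  have := hf.convex.1.add_smul_sub_mem hx hxv ht
  rwa [add_sub_cancel_left] at this

/-- The open Dikin ellipsoid is contained in the domain. -/
theorem add_mem_dom (hf : IsStandardSelfConcordant f) (hpos : HessianPosDef f)
    (hx : x ∈ dom f) (hr : localNorm f x v < 1) : x + v ∈ dom f := by
  have hr0 := localNorm_nonneg (f := f) x v
  set B : ℝ := realVal f x + |⟪gradient (realVal f) x, v⟫| + omegaStar (localNorm f x v) with hB
  have hcoe : ∀ y ∈ dom f, f y = (realVal f y : EReal) := fun y hy =>
    (EReal.coe_toReal hy (hf.ne_bot y)).symm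
  have hbound : ∀ t ∈ Icc (0 : ℝ) 1, x + t • v ∈ dom f → f (x + t • v) ≤ (B : EReal) := by
    intro t ht hy
    have hle : localNorm f x (t • v) ≤ localNorm f x v := by
      rw [localNorm_smul, abs_of_nonneg ht.1]
      exact mul_le_of_le_one_left hr0 ht.2
    have h := realVal_add_le_of_segment hf hpos (hf.segment_mem hx hy) (hle.trans_lt hr)
    have hω := strictMonoOn_omegaStar.monotoneOn ⟨localNorm_nonneg _ _, hle.trans_lt hr⟩
      ⟨hr0, hr⟩ hle
    have hg : ⟪gradient (realVal f) x, t • v⟫ ≤ |⟪gradient (realVal f) x, v⟫| := by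
      rw [inner_smul_right]
      exact (le_abs_self _).trans (by
        rw [abs_mul, abs_of_nonneg ht.1]
        exact mul_le_of_le_one_left (abs_nonneg _) ht.2)
    rw [hcoe _ hy, EReal.coe_le_coe_iff]
    linarith
  have hcont : Continuous fun t : ℝ => x + t • v := by fun_prop
  have hclosed : IsClosed {t : ℝ | f (x + t • v) ≤ (B : EReal)} :=
    (hf.closed.isClosed_preimage (B : EReal)).preimage hcont
  have hdom : ∀ {y}, f y ≤ (B : EReal) → y ∈ dom f := fun h => (h.trans_lt (EReal.coe_lt_top B)).ne
  -- Continuous induction on t: the sublevel set is closed by lower semicontinuity. It extends to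
  -- the right because the domain is open and the bound B holds wherever f is finite on the segment.
  have hsub : Icc (0 : ℝ) 1 ⊆ {t : ℝ | f (x + t • v) ≤ (B : EReal)} := by
    refine IsClosed.Icc_subset_of_forall_exists_gt (hclosed.inter isClosed_Icc)
      (hbound 0 (by simp) (by simpa using hx)) ?_
    rintro t ⟨htB, ht⟩ y hy
    have hev : ∀ᶠ s : ℝ in nhds t, x + s • v ∈ dom f :=
      hcont.continuousAt.eventually_mem (hf.isOpen_dom.mem_nhds (hdom htB))
    have hlt : t < min y 1 := lt_min hy ht.2
    obtain ⟨s, hs, hs'⟩ := ((hev.filter_mono nhdsWithin_le_nhds).and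
      (Ioc_mem_nhdsGT hlt)).exists
    exact ⟨s, hbound s ⟨ht.1.trans hs'.1.le, hs'.2.trans (min_le_right _ _)⟩ hs,
      hs'.1, hs'.2.trans (min_le_left _ _)⟩
  have := hdom (hsub (right_mem_Icc.2 zero_le_one))
  rwa [one_smul] at this

end Segment

end SelfConcordantMin

namespace SelfConcordantMin

variable {N : ℕ} {f : EuclideanSpace ℝ (Fin N) → EReal}

/-! ### The Newton direction -/

section NewtonDirection

variable {M : ℝ} {x : EuclideanSpace ℝ (Fin N)}

theorem HessianPosDef.exists_hessian_eq (hpos : HessianPosDef f) (hx : x ∈ dom f)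
    (g : EuclideanSpace ℝ (Fin N)) : ∃ d, hessian f x d = g := by
  have hinj : Function.Injective (hessian f x).toLinearMap := by
    rw [← LinearMap.ker_eq_bot, LinearMap.ker_eq_bot']
    intro u hu
    by_contra h
    have := hpos x hx u h
    rw [show hessian f x u = 0 from hu, inner_zero_right] at this
    exact this.false
  exact LinearMap.injective_iff_surjective.1 hinj g

theorem quadModel_eq_of_hessian_eq (hf : IsSelfConcordant M f) (hx : x ∈ dom f)
    {d : EuclideanSpace ℝ (Fin N)} (hd : hessian f x d = -gradient (realVal f) x)
    (e : EuclideanSpace ℝ (Fin N)) :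
    quadModel f x e = quadModel f x d + 1 / 2 * ⟪e - d, hessian f x (e - d)⟫ := by
  have hg : gradient (realVal f) x = -hessian f x d := by rw [hd, neg_neg]
  simp only [quadModel, hg, map_sub, inner_sub_left, inner_sub_right, inner_neg_left]
  rw [real_inner_comm e, real_inner_comm d, hf.hessian_symm hx d e]
  ring

theorem isNewtonDir_iff_of_hessian_eq (hf : IsSelfConcordant M f) (hpos : HessianPosDef f)
    (hx : x ∈ dom f) {d : EuclideanSpace ℝ (Fin N)}
    (hd : hessian f x d = -gradient (realVal f) x) (e : EuclideanSpace ℝ (Fin N)) :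
    IsNewtonDir f x e ↔ e = d := by
  constructor
  · intro he
    by_contra h
    have h1 := hpos x hx (e - d) (sub_ne_zero.2 h)
    have h2 : quadModel f x e ≤ quadModel f x d := he (mem_univ d)
    rw [quadModel_eq_of_hessian_eq hf hx hd e] at h2
    linarith
  · rintro rfl y -
    change quadModel f x e ≤ quadModel f x y
    rw [quadModel_eq_of_hessian_eq hf hx hd y]
    linarith [hpos.inner_nonneg hx (y - e)]

theorem hessian_newtonDir (hf : IsSelfConcordant M f) (hpos : HessianPosDef f)
    (hx : x ∈ dom f) : hessian f x (newtonDir f x) = -gradient (realVal f) x := by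
  obtain ⟨d, hd⟩ := hpos.exists_hessian_eq hx (-gradient (realVal f) x)
  have hiff := isNewtonDir_iff_of_hessian_eq hf hpos hx hd
  -- The choice operator is meaningful only because d is a minimizer.
  have : newtonDir f x = d :=
    (hiff _).1 (Classical.epsilon_spec (p := IsNewtonDir f x) ⟨d, (hiff d).2 rfl⟩)
  rw [this, hd]

theorem isNewtonDir_iff (hf : IsSelfConcordant M f) (hpos : HessianPosDef f)
    (hx : x ∈ dom f) (d : EuclideanSpace ℝ (Fin N)) :
    IsNewtonDir f x d ↔ d = newtonDir f x :=
  isNewtonDir_iff_of_hessian_eq hf hpos hx (hessian_newtonDir hf hpos hx) d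

theorem inner_gradient_eq (hf : IsSelfConcordant M f) (hpos : HessianPosDef f)
    (hx : x ∈ dom f) (u : EuclideanSpace ℝ (Fin N)) :
    ⟪gradient (realVal f) x, u⟫ = -⟪u, hessian f x (newtonDir f x)⟫ := by
  rw [hessian_newtonDir hf hpos hx, inner_neg_right, neg_neg, real_inner_comm]

theorem inner_gradient_newtonDir (hf : IsSelfConcordant M f) (hpos : HessianPosDef f)
    (hx : x ∈ dom f) :
    ⟪gradient (realVal f) x, newtonDir f x⟫ = -newtonDecrement f x ^ 2 := by
  rw [inner_gradient_eq hf hpos hx, newtonDecrement, hpos.localNorm_sq hx]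

theorem newtonDecrement_nonneg : 0 ≤ newtonDecrement f x := localNorm_nonneg _ _

end NewtonDirection

/-! ### One step of the damped Newton method and of the Newton method -/

section Step

variable {x : EuclideanSpace ℝ (Fin N)}

theorem localNorm_damped_step : localNorm f x ((1 + newtonDecrement f x)⁻¹ • newtonDir f x) =
    newtonDecrement f x / (1 + newtonDecrement f x) := by
  have h := newtonDecrement_nonneg (f := f) (x := x)
  rw [localNorm_smul, abs_of_nonneg (by positivity), inv_mul_eq_div]
  rfl

theorem dampedNewtonStep_mem_dom (hf : IsStandardSelfConcordant f) (hpos : HessianPosDef f)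
    (hx : x ∈ dom f) : dampedNewtonStep f x ∈ dom f := by
  have h := newtonDecrement_nonneg (f := f) (x := x)
  refine add_mem_dom hf hpos hx ?_
  rw [localNorm_damped_step, div_lt_one (by linarith)]
  linarith

/-- The step length 1/(1+λ) minimizes the upper bound -tλ² + ω_*(tλ) over t, and the minimal value
is -ω(λ). -/
theorem realVal_dampedNewtonStep_le (hf : IsStandardSelfConcordant f) (hpos : HessianPosDef f)
    (hx : x ∈ dom f) :
    realVal f (dampedNewtonStep f x) ≤ realVal f x - omega (newtonDecrement f x) := by
  have h := newtonDecrement_nonneg (f := f) (x := x)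
  have hlt : localNorm f x ((1 + newtonDecrement f x)⁻¹ • newtonDir f x) < 1 := by
    rw [localNorm_damped_step, div_lt_one (by linarith)]
    linarith
  have key := realVal_add_le_of_segment hf hpos
    (hf.segment_mem hx (dampedNewtonStep_mem_dom hf hpos hx)) hlt
  rw [localNorm_damped_step, omegaStar_div_one_add h, inner_smul_right,
    inner_gradient_newtonDir hf hpos hx] at key
  refine key.trans (le_of_eq ?_)
  field_simp
  ring

theorem newtonStep_mem_dom (hf : IsStandardSelfConcordant f) (hpos : HessianPosDef f)
    (hx : x ∈ dom f) (hlt : newtonDecrement f x < 1) : newtonStep f x ∈ dom f :=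
  add_mem_dom hf hpos hx hlt

/-- Local quadratic convergence of the Newton method. -/
theorem newtonDecrement_newtonStep_le (hf : IsStandardSelfConcordant f) (hpos : HessianPosDef f)
    (hx : x ∈ dom f) (hlt : newtonDecrement f x < 1) :
    newtonDecrement f (newtonStep f x) ≤
      newtonDecrement f x ^ 2 / (1 - newtonDecrement f x) ^ 2 := by
  have hy := newtonStep_mem_dom hf hpos hx hlt
  have hseg := hf.segment_mem hx hy
  set y := newtonStep f x with hydef
  set l := newtonDecrement f x with hl
  set m := newtonDecrement f y with hm
  have hm0 : 0 ≤ m := newtonDecrement_nonneg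
  -- Testing against minus the new Newton direction makes the left side m². The Newton equation at x
  -- cancels the gradient and Hessian terms, leaving only the linearization error.
  have h1 := inner_gradient_add_le_of_segment hf hpos hseg hlt (-newtonDir f y)
  have h2 := mul_localNorm_le_line hf hpos hseg hlt (newtonDir f y) (right_mem_Icc.2 zero_le_one)
  rw [one_smul, mul_one, show x + newtonDir f x = y from rfl] at h2
  rw [show x + newtonDir f x = y from rfl, inner_gradient_eq hf hpos hx, neg_add_cancel, zero_add,
    localNorm_neg, inner_neg_right, inner_gradient_newtonDir hf hpos hy, neg_neg] at h1
  change localNorm f x (newtonDir f y) * (1 - l) ≤ m at h2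
  change m ^ 2 ≤ l ^ 2 / (1 - l) * localNorm f x (newtonDir f y) at h1
  have h3 : 0 < 1 - l := by linarith
  rcases hm0.eq_or_lt with hm' | hm'
  · rw [← hm']
    positivity
  rw [← le_div_iff₀ h3] at h2
  have h4 : m * m ≤ l ^ 2 / (1 - l) ^ 2 * m := by
    calc m * m = m ^ 2 := (sq m).symm
      _ ≤ l ^ 2 / (1 - l) * localNorm f x (newtonDir f y) := h1
      _ ≤ l ^ 2 / (1 - l) * (m / (1 - l)) := by gcongr
      _ = _ := by field_simp
  exact le_of_mul_le_mul_right h4 hm'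

/-- With r = ‖z-x‖_x, the lower bound and Cauchy–Schwarz give f(x) - f(z) ≤ λr - ω(r), and
Fenchel–Young removes r. -/
theorem realVal_sub_le_omegaStar (hf : IsStandardSelfConcordant f) (hpos : HessianPosDef f)
    (hx : x ∈ dom f) (hlt : newtonDecrement f x < 1) {z : EuclideanSpace ℝ (Fin N)}
    (hz : z ∈ dom f) : realVal f x - realVal f z ≤ omegaStar (newtonDecrement f x) := by
  have hxz : x + (z - x) = z := by abel
  have h1 := le_realVal_add_of_segment hf hpos (hf.segment_mem hx (v := z - x) (by rwa [hxz]))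
  rw [hxz, inner_gradient_eq hf hpos hx] at h1
  have h2 := hpos.inner_hessian_le hf hx (z - x) (newtonDir f x)
  have h3 := mul_le_omega_add_omegaStar (localNorm_nonneg (f := f) x (z - x)) hlt
  have h4 : localNorm f x (z - x) * localNorm f x (newtonDir f x) =
    newtonDecrement f x * localNorm f x (z - x) := mul_comm _ _
  linarith

end Step

/-! ### The optimality gap -/

section Gap

variable {z : EuclideanSpace ℝ (Fin N)}

theorem iInf_eq_of_isMinOn (hz : IsMinOn f univ z) : ⨅ y, f y = f z :=
  le_antisymm (iInf_le f z) (le_iInf fun y => hz (mem_univ y))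

theorem mem_dom_of_isMinOn (hz : IsMinOn f univ z) {x : EuclideanSpace ℝ (Fin N)}
    (hx : x ∈ dom f) : z ∈ dom f :=
  ((hz (mem_univ x) : f z ≤ f x).trans_lt (lt_top_iff_ne_top.2 hx)).ne

theorem optGap_eq (hz : IsMinOn f univ z) (x : EuclideanSpace ℝ (Fin N)) :
    optGap f x = realVal f x - realVal f z := by
  rw [optGap, iInf_eq_of_isMinOn hz]
  rfl

theorem optGap_nonneg {M : ℝ} (hf : IsSelfConcordant M f) (hz : IsMinOn f univ z)
    {x : EuclideanSpace ℝ (Fin N)} (hx : x ∈ dom f) : 0 ≤ optGap f x := by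
  rw [optGap_eq hz, sub_nonneg]
  exact EReal.toReal_le_toReal (hz (mem_univ x)) (hf.ne_bot z) hx

theorem optGap_dampedNewtonStep_le (hf : IsStandardSelfConcordant f) (hpos : HessianPosDef f)
    (hz : IsMinOn f univ z) {x : EuclideanSpace ℝ (Fin N)} (hx : x ∈ dom f) :
    optGap f (dampedNewtonStep f x) ≤ optGap f x - omega (newtonDecrement f x) := by
  rw [optGap_eq hz, optGap_eq hz]
  linarith [realVal_dampedNewtonStep_le hf hpos hx]

/-- For λ < 1, invert the bound of the gap by ω_*(λ); for λ ≥ 1 nothing is needed, as the inverse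
takes values below 1. -/
theorem omegaStarInv_optGap_le (hf : IsStandardSelfConcordant f) (hpos : HessianPosDef f)
    (hz : IsMinOn f univ z) {x : EuclideanSpace ℝ (Fin N)} (hx : x ∈ dom f) :
    omegaStarInv (optGap f x) ≤ newtonDecrement f x := by
  have h0 := optGap_nonneg hf hz hx
  rcases lt_or_ge (newtonDecrement f x) 1 with hlt | hge
  · refine (strictMonoOn_omegaStar.le_iff_le (omegaStarInv_mem h0)
      ⟨newtonDecrement_nonneg, hlt⟩).1 ?_
    rw [omegaStar_omegaStarInv h0, optGap_eq hz]
    exact realVal_sub_le_omegaStar hf hpos hx hlt (mem_dom_of_isMinOn hz hx)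
  · exact (omegaStarInv_mem h0).2.le.trans hge

theorem omegaStarInv_le_omegaStarInv {s t : ℝ} (hs : 0 ≤ s) (hst : s ≤ t) :
    omegaStarInv s ≤ omegaStarInv t := by
  have ht := hs.trans hst
  refine (strictMonoOn_omegaStar.le_iff_le (omegaStarInv_mem hs) (omegaStarInv_mem ht)).1 ?_
  rwa [omegaStar_omegaStarInv hs, omegaStar_omegaStarInv ht]

/-- The damped Newton method decreases the optimality gap by a constant factor on a sublevel set. -/
theorem optGap_dampedNewtonStep_le_mul (hf : IsStandardSelfConcordant f)
    (hpos : HessianPosDef f) (hz : IsMinOn f univ z) {x : EuclideanSpace ℝ (Fin N)}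
    (hx : x ∈ dom f) {δ : ℝ} (hδ : optGap f x ≤ δ) :
    optGap f (dampedNewtonStep f x) ≤
      (1 - (1 - omegaStarInv δ) / (1 + omegaStarInv δ)) * optGap f x := by
  have h0 := optGap_nonneg hf hz hx
  have ht := omegaStarInv_mem h0
  have hT := omegaStarInv_mem (h0.trans hδ)
  have htT := omegaStarInv_le_omegaStarInv h0 hδ
  have h1 := optGap_dampedNewtonStep_le hf hpos hz hx
  have h2 := strictMonoOn_omega.monotoneOn (mem_Ici.2 ht.1) (mem_Ici.2 newtonDecrement_nonneg)
    (omegaStarInv_optGap_le hf hpos hz hx)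
  have h3 := mul_omegaStar_le_omega ht
  rw [omegaStar_omegaStarInv h0] at h3
  set t := omegaStarInv (optGap f x)
  set T := omegaStarInv δ
  -- (1-t)/(1+t) decreases in t, so the rate at the level δ serves for all smaller gaps.
  have h4 : (1 - T) / (1 + T) ≤ (1 - t) / (1 + t) := by
    rw [div_le_div_iff₀ (by linarith [hT.1]) (by linarith [ht.1])]
    linarith
  have h5 := mul_le_mul_of_nonneg_right h4 h0
  linarith

end Gap

/-! ### The two stages -/

section Stages

variable {z : EuclideanSpace ℝ (Fin N)} {x : ℕ → EuclideanSpace ℝ (Fin N)} {β : ℝ}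

/-- The additive decrease keeps every gap below the initial one; this is what allows one contraction
factor for all steps. -/
theorem stageOne_iterates (hf : IsStandardSelfConcordant f) (hpos : HessianPosDef f)
    (hz : IsMinOn f univ z) (hβ : 0 < β) (hx : x 0 ∈ dom f) {K : ℕ}
    (hK : ∀ k < K, β < newtonDecrement f (x k) ∧ x (k + 1) = dampedNewtonStep f (x k)) :
    ∀ k ≤ K, x k ∈ dom f ∧ optGap f (x k) + k * omega β ≤ optGap f (x 0) ∧
      optGap f (x k) ≤ (1 - (1 - omegaStarInv (optGap f (x 0))) /
        (1 + omegaStarInv (optGap f (x 0)))) ^ k * optGap f (x 0) := by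
  intro k
  induction k with
  | zero => exact fun _ => ⟨hx, by simp, by simp⟩
  | succ k ih =>
    intro hk
    obtain ⟨h1, h2, h3⟩ := ih (Nat.le_of_succ_le hk)
    obtain ⟨hlt, hstep⟩ := hK k hk
    have hδ : optGap f (x k) ≤ optGap f (x 0) := by
      have := mul_nonneg (Nat.cast_nonneg (α := ℝ) k) (omega_pos hβ).le
      linarith
    rw [hstep]
    refine ⟨dampedNewtonStep_mem_dom hf hpos h1, ?_, ?_⟩
    · have h4 := optGap_dampedNewtonStep_le hf hpos hz h1
      have h5 := strictMonoOn_omega (mem_Ici.2 hβ.le) (mem_Ici.2 (hβ.trans hlt).le) hlt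
      push_cast
      linarith
    · have h4 := optGap_dampedNewtonStep_le_mul hf hpos hz h1 hδ
      have hT := omegaStarInv_mem (optGap_nonneg hf hz hx)
      set T := omegaStarInv (optGap f (x 0))
      have hq : 0 ≤ 1 - (1 - T) / (1 + T) := by
        rw [sub_nonneg, div_le_one (by linarith [hT.1])]
        linarith [hT.1]
      refine h4.trans ((mul_le_mul_of_nonneg_left h3 hq).trans (le_of_eq ?_))
      rw [pow_succ]
      ring

theorem stageOne_le (hf : IsStandardSelfConcordant f) (hpos : HessianPosDef f)
    (hz : IsMinOn f univ z) (hβ : 0 < β) (hx : x 0 ∈ dom f) {K : ℕ}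
    (hK : ∀ k < K, β < newtonDecrement f (x k) ∧ x (k + 1) = dampedNewtonStep f (x k)) :
    (K : ℤ) ≤ stageOneBound β (optGap f (x 0)) := by
  have hit := stageOne_iterates hf hpos hz hβ hx hK
  have hω := omega_pos hβ
  refine le_min ?_ ?_
  · rcases K with _ | K
    · exact_mod_cast Int.ceil_nonneg (le_max_right _ _)
    obtain ⟨h1, h2, h3⟩ := hit K K.le_succ
    obtain ⟨hlt, hstep⟩ := hK K K.lt_succ_self
    have hy := optGap_nonneg hf hz (dampedNewtonStep_mem_dom hf hpos h1)
    have h4 := optGap_dampedNewtonStep_le hf hpos hz h1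
    have h5 := strictMonoOn_omega (mem_Ici.2 hβ.le) (mem_Ici.2 (hβ.trans hlt).le) hlt
    -- Even the last iterate before the final damped step has gap above ω(β), since that step
    -- removes more than ω(β) and leaves a nonnegative gap. The strict inequality at index K pays
    -- for the extra step in K + 1.
    have hgt : omega β < optGap f (x K) := by linarith
    have hδ : 0 < optGap f (x 0) := by
      have := mul_nonneg (Nat.cast_nonneg (α := ℝ) K) hω.le
      linarith
    have hT := omegaStarInv_mem hδ.le
    have hTe := omegaStar_omegaStarInv hδ.le
    set δ := optGap f (x 0)
    set T := omegaStarInv δ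
    -- T > 0 makes the contraction factor 2T/(1+T) positive, so that its logarithm is genuine.
    have hT0 : 0 < T := by
      refine hT.1.lt_of_ne fun h => ?_
      rw [← h, omegaStar_zero] at hTe
      exact hδ.ne hTe
    have hT1 : 0 < 1 + T := by linarith
    have hq0 : 0 < 1 - (1 - T) / (1 + T) := by
      rw [sub_pos, div_lt_one hT1]
      linarith
    have hq1 : 1 - (1 - T) / (1 + T) < 1 := by
      have : 0 < (1 - T) / (1 + T) := div_pos (by linarith [hT.2]) hT1
      linarith
    set q := 1 - (1 - T) / (1 + T)
    have hlog : Real.log (omega β) < K * Real.log q + Real.log δ := by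
      rw [← Real.log_pow, ← Real.log_mul (pow_pos hq0 K).ne' hδ.ne']
      exact Real.log_lt_log hω (hgt.trans_le h3)
    have hK' : (K : ℝ) < (Real.log (omega β) - Real.log δ) / Real.log q := by
      rw [lt_div_iff_of_neg (Real.log_neg hq0 hq1)]
      linarith
    have : (K : ℤ) < ⌈max ((Real.log (omega β) - Real.log δ) / Real.log q) 0⌉ := by
      rw [Int.lt_ceil]
      exact_mod_cast hK'.trans_le (le_max_left _ _)
    push_cast
    omega
  · obtain ⟨h1, h2, -⟩ := hit K le_rfl
    have hy := optGap_nonneg hf hz h1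
    have : (K : ℝ) ≤ optGap f (x 0) / omega β := by
      rw [le_div_iff₀ hω]
      linarith
    exact_mod_cast this.trans (Int.le_ceil _)

/-- (3-√5)/2 is the smaller root of (1-β)² = β. -/
theorem div_one_sub_sq_lt_one (hβ : β ∈ Ioo (0 : ℝ) ((3 - √5) / 2)) :
    β < 1 ∧ β / (1 - β) ^ 2 < 1 := by
  have h5 : √5 ^ 2 = 5 := Real.sq_sqrt (by norm_num)
  have h0 : 2 < √5 := Real.lt_sqrt_of_sq_lt (by norm_num)
  have h1 : β < 1 := by linarith [hβ.2]
  refine ⟨h1, ?_⟩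
  rw [div_lt_one (by nlinarith)]
  nlinarith [hβ.1, hβ.2]

/-- Since λ ≤ β persists, λ₊/(1-β)² ≤ (λ/(1-β)²)², whence the exponent 2^j. -/
theorem stageTwo_iterates (hf : IsStandardSelfConcordant f) (hpos : HessianPosDef f)
    (hβ : β ∈ Ioo (0 : ℝ) ((3 - √5) / 2)) {K m : ℕ} (hx : x K ∈ dom f)
    (hxβ : newtonDecrement f (x K) ≤ β)
    (hm : ∀ j < m, x (K + j + 1) = newtonStep f (x (K + j))) :
    ∀ j ≤ m, x (K + j) ∈ dom f ∧ newtonDecrement f (x (K + j)) ≤ β ∧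
      newtonDecrement f (x (K + j)) ≤ (1 - β) ^ 2 * (β / (1 - β) ^ 2) ^ 2 ^ j := by
  obtain ⟨hβ1, ha⟩ := div_one_sub_sq_lt_one hβ
  have hc : 0 < (1 - β) ^ 2 := pow_pos (by linarith) 2
  intro j
  induction j with
  | zero =>
    refine fun _ => ⟨hx, hxβ, ?_⟩
    rw [pow_zero, pow_one, mul_div_cancel₀ _ hc.ne']
    exact hxβ
  | succ j ih =>
    intro hj
    obtain ⟨h1, h2, h3⟩ := ih (Nat.le_of_succ_le hj)
    have hlt := h2.trans_lt hβ1
    have h0 := newtonDecrement_nonneg (f := f) (x := x (K + j))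
    have h4 := newtonDecrement_newtonStep_le hf hpos h1 hlt
    rw [← add_assoc, hm j hj]
    set l := newtonDecrement f (x (K + j))
    have h5 : newtonDecrement f (newtonStep f (x (K + j))) ≤ l ^ 2 / (1 - β) ^ 2 := by
      refine h4.trans ?_
      have : 0 < 1 - β := by linarith
      gcongr
    refine ⟨newtonStep_mem_dom hf hpos h1 hlt, h5.trans ?_, h5.trans ?_⟩
    · calc l ^ 2 / (1 - β) ^ 2 ≤ β ^ 2 / (1 - β) ^ 2 := by gcongr
        _ = β * (β / (1 - β) ^ 2) := by ring
        _ ≤ β := mul_le_of_le_one_right hβ.1.le ha.le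
    · calc l ^ 2 / (1 - β) ^ 2
          ≤ ((1 - β) ^ 2 * (β / (1 - β) ^ 2) ^ 2 ^ j) ^ 2 / (1 - β) ^ 2 := by gcongr
        _ = (1 - β) ^ 2 * ((β / (1 - β) ^ 2) ^ 2 ^ j) ^ 2 := by
          rw [mul_pow, sq ((1 - β) ^ 2), mul_assoc, mul_div_cancel_left₀ _ hc.ne']
        _ = _ := by rw [← pow_mul, ← pow_succ]

theorem stageTwo_le (hf : IsStandardSelfConcordant f) (hpos : HessianPosDef f)
    (hβ : β ∈ Ioo (0 : ℝ) ((3 - √5) / 2)) {ε : ℝ} (hε : 0 < ε) {K m : ℕ} (hx : x K ∈ dom f)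
    (hxβ : newtonDecrement f (x K) ≤ β)
    (hm : ∀ j < m, ε < newtonDecrement f (x (K + j)) ∧ x (K + j + 1) = newtonStep f (x (K + j))) :
    (m : ℤ) ≤ stageTwoBound β ε := by
  obtain ⟨hβ1, ha⟩ := div_one_sub_sq_lt_one hβ
  have h1β : 0 < 1 - β := by linarith
  have hit := stageTwo_iterates hf hpos hβ hx hxβ (m := m) fun j hj => (hm j hj).2
  unfold stageTwoBound
  split_ifs with hεβ
  · have ha0 : 0 < β / (1 - β) ^ 2 := div_pos hβ.1 (pow_pos h1β 2)
    have hloga := Real.log_neg ha0 ha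
    have hlog : ∀ s, 0 < s → Real.log s - 2 * Real.log (1 - β) = Real.log (s / (1 - β) ^ 2) := by
      intro s hs
      rw [Real.log_div hs.ne' (pow_pos h1β 2).ne', Real.log_pow]
      norm_num
    rw [hlog ε hε, hlog β hβ.1]
    rcases m with _ | m
    -- With no iterations the bound must still be nonnegative: both logarithms are negative and ε ≤
    -- β, so their ratio is at least 1.
    · have h1 : Real.log (ε / (1 - β) ^ 2) ≤ Real.log (β / (1 - β) ^ 2) :=
        Real.log_le_log (div_pos hε (pow_pos h1β 2)) (by gcongr)
      exact_mod_cast Int.ceil_nonneg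
        (Real.logb_nonneg one_lt_two ((one_le_div_of_neg hloga).2 h1))
    · obtain ⟨-, -, h3⟩ := hit m m.le_succ
      obtain ⟨h4, -⟩ := hm m m.lt_succ_self
      -- Index m is the last iterate still above ε. Dividing by the negative logarithm below
      -- reverses the inequality, and strictness yields m + 1 ≤ ⌈·⌉.
      have h5 : ε / (1 - β) ^ 2 < (β / (1 - β) ^ 2) ^ 2 ^ m := by
        rw [div_lt_iff₀' (pow_pos h1β 2)]
        exact h4.trans_le h3
      have h6 := Real.log_lt_log (div_pos hε (pow_pos h1β 2)) h5
      rw [Real.log_pow] at h6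
      push_cast at h6
      have h7 : (2 : ℝ) ^ m < Real.log (ε / (1 - β) ^ 2) / Real.log (β / (1 - β) ^ 2) := by
        rwa [lt_div_iff_of_neg hloga]
      have h8 : (m : ℤ) <
          ⌈Real.logb 2 (Real.log (ε / (1 - β) ^ 2) / Real.log (β / (1 - β) ^ 2))⌉ := by
        rw [Int.lt_ceil, Int.cast_natCast,
          Real.lt_logb_iff_rpow_lt one_lt_two ((by positivity : (0 : ℝ) < 2 ^ m).trans h7),
          Real.rpow_natCast]
        exact h7
      push_cast
      omega
  · rcases m with _ | m
    · simp
    · have := (hm 0 m.succ_pos).1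
      rw [add_zero] at this
      linarith

end Stages

end SelfConcordantMin

namespace SelfConcordantMin

variable {N : ℕ} {f : EuclideanSpace ℝ (Fin N) → EReal} {z : EuclideanSpace ℝ (Fin N)} {β ε : ℝ}

/-! ### The mixture of the two methods -/

/-- Otherwise the gap would fall by ω(β) forever and become negative. -/
theorem exists_stageOne (hf : IsStandardSelfConcordant f) (hpos : HessianPosDef f)
    (hz : IsMinOn f univ z) (hβ : 0 < β) {x₀ : EuclideanSpace ℝ (Fin N)} (hx₀ : x₀ ∈ dom f) :
    ∃ k, newtonDecrement f ((dampedNewtonStep f)^[k] x₀) ≤ β := by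
  by_contra! h
  obtain ⟨n, hn⟩ := exists_nat_gt (optGap f x₀ / omega β)
  rw [div_lt_iff₀ (omega_pos hβ)] at hn
  obtain ⟨h1, h2, -⟩ := stageOne_iterates hf hpos hz hβ
    (x := fun k => (dampedNewtonStep f)^[k] x₀) (K := n) (by simpa using hx₀)
    (fun k _ => ⟨h k, Function.iterate_succ_apply' _ _ _⟩) n le_rfl
  have h3 := optGap_nonneg hf hz h1
  simp only [Function.iterate_zero, id] at h2
  linarith

/-- The bound of `stageTwo_le` holds for every initial piece that stays above ε, so the sequence
cannot stay there forever. -/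
theorem exists_stageTwo (hf : IsStandardSelfConcordant f) (hpos : HessianPosDef f)
    (hβ : β ∈ Ioo (0 : ℝ) ((3 - √5) / 2)) (hε : 0 < ε) {x₀ : EuclideanSpace ℝ (Fin N)}
    (hx₀ : x₀ ∈ dom f) (hxβ : newtonDecrement f x₀ ≤ β) :
    ∃ k, newtonDecrement f ((newtonStep f)^[k] x₀) ≤ ε := by
  by_contra! h
  obtain ⟨n, hn⟩ := exists_nat_gt (stageTwoBound β ε : ℝ)
  have := stageTwo_le hf hpos hβ hε (x := fun k => (newtonStep f)^[k] x₀) (K := 0) (m := n)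
    (by simpa using hx₀) (by simpa using hxβ)
    (fun j _ => ⟨h _, Function.iterate_succ_apply' _ _ _⟩)
  have h1 : ((n : ℤ) : ℝ) ≤ stageTwoBound β ε := by exact_mod_cast this
  rw [Int.cast_natCast] at h1
  linarith

theorem exists_isMixtureRun (hf : IsStandardSelfConcordant f) (hpos : HessianPosDef f)
    (hz : IsMinOn f univ z) (hβ : β ∈ Ioo (0 : ℝ) ((3 - √5) / 2)) (hε : 0 < ε)
    {x₀ : EuclideanSpace ℝ (Fin N)} (hx₀ : x₀ ∈ dom f) :
    ∃ (x : ℕ → EuclideanSpace ℝ (Fin N)) (K₁ K₂ : ℕ), IsMixtureRun f β ε x₀ x K₁ K₂ := by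
  classical
  have h1 := exists_stageOne hf hpos hz hβ.1 hx₀
  have hdamped : ∀ k < Nat.find h1, β < newtonDecrement f ((dampedNewtonStep f)^[k] x₀) ∧
      (dampedNewtonStep f)^[k + 1] x₀ = dampedNewtonStep f ((dampedNewtonStep f)^[k] x₀) :=
    fun k hk => ⟨not_le.1 (Nat.find_min h1 hk), Function.iterate_succ_apply' _ _ _⟩
  have hmem := (stageOne_iterates hf hpos hz hβ.1 (x := fun k => (dampedNewtonStep f)^[k] x₀)
    (by simpa using hx₀) hdamped _ le_rfl).1
  have hsw := Nat.find_spec h1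
  set K := Nat.find h1
  set y := (dampedNewtonStep f)^[K] x₀ with hy
  have h2 := exists_stageTwo hf hpos hβ hε hmem hsw
  -- Both formulas agree at the switching index K, so the glued sequence follows the Newton
  -- iteration from K on.
  have hx : ∀ k, K ≤ k → (if k ≤ K then (dampedNewtonStep f)^[k] x₀
      else (newtonStep f)^[k - K] y) = (newtonStep f)^[k - K] y := by
    intro k hk
    split_ifs with h
    · obtain rfl := le_antisymm h hk
      simp [hy]
    · rfl
  refine ⟨fun k => if k ≤ K then (dampedNewtonStep f)^[k] x₀ else (newtonStep f)^[k - K] y,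
    K, K + Nat.find h2, ?_, Nat.le_add_right _ _, ?_, ?_, ?_, ?_⟩
  · simp
  · intro k hk
    simp only [hk.le, Nat.succ_le_of_lt hk, if_true]
    exact hdamped k hk
  · simpa using hsw
  · intro k hk hk'
    simp only [hx k hk, hx (k + 1) (hk.trans k.le_succ)]
    refine ⟨not_le.1 (Nat.find_min h2 (by omega)), ?_⟩
    rw [Nat.sub_add_comm hk, Function.iterate_succ_apply']
  · refine (congrArg (newtonDecrement f) (hx _ (Nat.le_add_right K _))).trans_le ?_
    rw [Nat.add_sub_cancel_left]
    exact Nat.find_spec h2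

section Run

variable {x₀ : EuclideanSpace ℝ (Fin N)} {x : ℕ → EuclideanSpace ℝ (Fin N)} {K₁ K₂ : ℕ}

theorem IsMixtureRun.newton_add (h : IsMixtureRun f β ε x₀ x K₁ K₂) :
    ∀ j < K₂ - K₁, ε < newtonDecrement f (x (K₁ + j)) ∧
      x (K₁ + j + 1) = newtonStep f (x (K₁ + j)) :=
  fun j hj => h.newton (K₁ + j) (Nat.le_add_right _ _) (by omega)

theorem IsMixtureRun.mem_dom (h : IsMixtureRun f β ε x₀ x K₁ K₂)
    (hf : IsStandardSelfConcordant f) (hpos : HessianPosDef f) (hz : IsMinOn f univ z)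
    (hβ : β ∈ Ioo (0 : ℝ) ((3 - √5) / 2)) (hx₀ : x₀ ∈ dom f) : ∀ k ≤ K₂, x k ∈ dom f := by
  have h1 := stageOne_iterates hf hpos hz hβ.1 (h.init ▸ hx₀) h.damped
  intro k hk
  rcases le_total k K₁ with hkK | hkK
  · exact (h1 k hkK).1
  · have := (stageTwo_iterates hf hpos hβ (h1 K₁ le_rfl).1 h.switch
      (fun j hj => (h.newton_add j hj).2) (k - K₁) (by omega)).1
    rwa [Nat.add_sub_cancel' hkK] at this

theorem IsMixtureRun.iterations_le (h : IsMixtureRun f β ε x₀ x K₁ K₂)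
    (hf : IsStandardSelfConcordant f) (hpos : HessianPosDef f) (hz : IsMinOn f univ z)
    (hβ : β ∈ Ioo (0 : ℝ) ((3 - √5) / 2)) (hε : 0 < ε) (hx₀ : x₀ ∈ dom f) :
    (K₂ : ℤ) ≤ stageOneBound β (optGap f x₀) + stageTwoBound β ε := by
  have h1 := stageOne_le hf hpos hz hβ.1 (h.init ▸ hx₀) h.damped
  have h2 := stageTwo_le hf hpos hβ hε (h.mem_dom hf hpos hz hβ hx₀ K₁ h.le) h.switch h.newton_add
  rw [h.init] at h1
  have := h.le
  omega

end Run

end SelfConcordantMin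

theorem mainTheorem7 {N : ℕ} (f : EuclideanSpace ℝ (Fin N) → EReal)
    (hf : SelfConcordantMin.IsStandardSelfConcordant f)
    (hpos : ∀ x ∈ SelfConcordantMin.dom f, ∀ u : EuclideanSpace ℝ (Fin N), u ≠ 0 →
      0 < inner ℝ u (SelfConcordantMin.hessian f x u))
    (hmin : ∃! z : EuclideanSpace ℝ (Fin N), IsMinOn f Set.univ z)
    (x₀ : EuclideanSpace ℝ (Fin N)) (hx₀ : x₀ ∈ SelfConcordantMin.dom f)
    (β : ℝ) (hβ : β ∈ Set.Ioo (0 : ℝ) ((3 - Real.sqrt 5) / 2))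
    (ε : ℝ) (hε : 0 < ε) :
    (∃ (x : ℕ → EuclideanSpace ℝ (Fin N)) (K₁ K₂ : ℕ),
      SelfConcordantMin.IsMixtureRun f β ε x₀ x K₁ K₂) ∧
    ∀ (x : ℕ → EuclideanSpace ℝ (Fin N)) (K₁ K₂ : ℕ),
      SelfConcordantMin.IsMixtureRun f β ε x₀ x K₁ K₂ →
        (∀ k ≤ K₂, x k ∈ SelfConcordantMin.dom f ∧
          ∀ d, SelfConcordantMin.IsNewtonDir f (x k) d ↔
            d = SelfConcordantMin.newtonDir f (x k)) ∧
        (K₂ : ℤ) ≤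
          SelfConcordantMin.stageOneBound β (SelfConcordantMin.optGap f x₀) +
            SelfConcordantMin.stageTwoBound β ε := by
  obtain ⟨z, hz, -⟩ := hmin
  refine ⟨SelfConcordantMin.exists_isMixtureRun hf hpos hz hβ hε hx₀, fun x K₁ K₂ h => ?_⟩
  have hmem := h.mem_dom hf hpos hz hβ hx₀
  exact ⟨fun k hk => ⟨hmem k hk, SelfConcordantMin.isNewtonDir_iff hf hpos (hmem k hk)⟩,
    h.iterations_le hf hpos hz hβ hε hx₀⟩
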